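/- Let $H_1,H_2$ be complex Hilbert spaces, let $\Omega_1,\Omega_2$ be (possibly unbounded) self-adjoint operators in $H_1$ and $H_2$, let $\Gamma:H_2\to H_1$ be a bounded linear operator, and on $\mathcal H=H_1\oplus H_2$ let $$\Omega=\begin{pmatrix}\Omega_1&\Gamma\\ \Gamma^\dagger&\Omega_2\end{pmatrix},\qquad \mathrm{Dom}\,\Omega=\mathrm{Dom}\,\Omega_1\oplus\mathrm{Dom}\,\Omega_2 .$$ For a self-adjoint operator $A$ in a Hilbert space $H$ and $S\subseteq H$, let $\mathcal O_A(S)$ be the closure of the span of $\{f(A)w: f\in C_c(\mathbb R),\,w\in S\}$; a closed subspace $K$ is called $A$-invariant if $\mathcal O_A(K)=K$. Put $a_1(t)=\Gamma e^{-i\Omega_2t}\Gamma^\dagger$ and $a_2(t)=\Gamma^\dagger e^{-i\Omega_1t}\Gamma$. An open system $(H_1,\Omega_1,a)$, with $a(t)$ an operator-valued function on $t\ge 0$, has the *minimal conservative extension* $(H_1\oplus G,\ \Omega_1,\ \Omega_G,\ \Gamma_G)$ if $\Omega_1$ and $\Omega_G$ are self-adjoint in $H_1$ and $G$, $\Gamma_G:G\to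 H_1$ is bounded, $a(t)=\Gamma_Ge^{-i\Omega_Gt}\Gamma_G^\dagger$ for all $t\ge0$, and $\mathcal O_{\Omega_G}(\mathrm{Ran}\,\Gamma_G^\dagger)=G$; similarly with the two components exchanged. It is *contained in* $\mathcal H$ if it is the restriction of $(\mathcal H,\Omega)$ to an $\Omega$-invariant closed subspace of $\mathcal H$ of the form $H_1\oplus G$ with $G\subseteq H_2$. A coupled system $(H_1\oplus H_2,\Omega)$ is *reconstructible* if it is a minimal conservative extension of each of its open systems $(H_1,\Omega_1,a_1)$ and $(H_2,\Omega_2,a_2)$. Then among the closed subspaces $K$ of $\mathcal H$ such that (a) $K$ is $\Omega$-invariant, (b) $K=K_1\oplus K_2$ with $K_i\subseteq H_i$, and (c) $\mathrm{Ran}\,\Gamma\subseteq K$, there is a smallest one, $\mathcal H'=H_{1c}\oplus H_{2c}$, and it is the only minimal one; the restriction $\Omega\!\upharpoonright\!\mathcal H'$ is self-adjoint, $\Gamma(H_{2c})\subseteq H_{1c}$ and $\Gamma^\dagger(H_{1c})\subseteq H_{2c}$. With $\Omega_{ic}=\Omega_i\!\upharpoonright\! H_{ic}$ and $\Gamma_c=\Gamma\!\upharpoonright\!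 H_{2c}:H_{2c}\to H_{1c}$ the following hold. (i) $H_{1c}=\mathcal O_{\Omega_1}(\mathrm{Ran}\,\Gamma)$ and $H_{2c}=\mathcal O_{\Omega_2}(\mathrm{Ran}\,\Gamma^\dagger)$. (ii) The subsystem $(\mathcal H',\Omega\!\upharpoonright\!\mathcal H')$ is reconstructible. $H_1\oplus H_{2c}=\mathcal O_\Omega(H_1)$ is the unique minimal conservative extension of $(H_1,\Omega_1,a_1)$ contained in $\mathcal H$, and $H_{1c}\oplus H_2=\mathcal O_\Omega(H_2)$ is the unique minimal conservative extension of $(H_2,\Omega_2,a_2)$ contained in $\mathcal H$. (iii) For all $t$: $a_1(t)\!\upharpoonright\! H_{1c}=\Gamma_ce^{-i\Omega_{2c}t}\Gamma_c^\dagger$ and $a_1(t)\!\upharpoonright\!(H_1\ominus H_{1c})=0$; $a_2(t)\!\upharpoonright\! H_{2c}=\Gamma_c^\dagger e^{-i\Omega_{1c}t}\Gamma_c$ and $a_2(t)\!\upharpoonright\!(H_2\ominus H_{2c})=0$. Moreover, neither $a_1$ nor $a_2$ is determined by any $\Omega$-invariant subspace $\tilde H_1\oplus\tilde H_2\subsetneq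 H_{1c}\oplus H_{2c}$ with $\tilde H_i\subseteq H_i$. Here $\tilde H_1\oplus\tilde H_2$ *determines* $a_1$ if, for all $t\ge0$, $a_1(t)\!\upharpoonright\!\tilde H_1$ is the corresponding friction function $\tilde\Gamma e^{-i\tilde\Omega_2t}\tilde\Gamma^\dagger$ of the restricted system and $a_1(t)$ vanishes on $H_1\ominus\tilde H_1$; similarly for $a_2$. (iv) $(H_1\oplus H_2,\Omega)$ is reconstructible if and only if neither $H_1$ nor $H_2$ contains a nonzero $\Omega$-invariant closed subspace (where $H_1$ and $H_2$ themselves count as such subspaces when they are $\Omega$-invariant). -/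

import Mathlib

open Filter Topology
open scoped CompactlySupported ENNReal

noncomputable section

namespace LinearPMap

section Operator

variable {H : Type*} [NormedAddCommGroup H] [InnerProductSpace ℂ H]

/-- `R` is the bounded inverse `(A + i)⁻¹` of `A + i`: every `R v` lies in the domain of `A`
and `(A + i) (R v) = v`. For self-adjoint `A` there is exactly one such `R`. -/
def IsResolventAtNegI (A : H →ₗ.[ℂ] H) (R : H →L[ℂ] H) : Prop :=
  ∀ v : H, ∃ h : R v ∈ A.domain, A ⟨R v, h⟩ + Complex.I • R v = v

open Classical in
/-- The bounded operator `(A + i)⁻¹` (zero if it does not exist). -/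
def resolventAtNegI (A : H →ₗ.[ℂ] H) : H →L[ℂ] H :=
  if h : ∃ R : H →L[ℂ] H, A.IsResolventAtNegI R then h.choose else 0

/-- The Cayley transform `U = (A - i) (A + i)⁻¹ = 1 - 2 i (A + i)⁻¹`, a unitary operator when `A`
is self-adjoint. -/
def cayley (A : H →ₗ.[ℂ] H) : H →L[ℂ] H :=
  1 - (2 * Complex.I) • A.resolventAtNegI

/-- The function on the unit circle corresponding to the function `f` on the real line under the
Cayley map `lam ↦ z = (lam - i) / (lam + i)`, whose inverse is `z ↦ i (1 + z) / (1 - z)`;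
the point `z = 1` corresponds to infinity, where the value is `0`. -/
def onCircle (f : ℝ → ℂ) (z : ℂ) : ℂ :=
  if z = 1 then 0 else f (Complex.I * (1 + z) / (1 - z)).re

/-- The restriction `A ↾ K` of a (possibly unbounded) operator to a closed subspace `K`, as an
operator in `K`: its domain consists of the `v ∈ K ∩ Dom A` with `A v ∈ K` (the last condition
being automatic when `K` is invariant). -/
def restrictTo (A : H →ₗ.[ℂ] H) (K : ClosedSubmodule ℂ H) :
    K.toSubmodule →ₗ.[ℂ] K.toSubmodule where
  domain :=
    { carrier := {v | ∃ h : (v : H) ∈ A.domain, A ⟨v, h⟩ ∈ K}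
      zero_mem' := ⟨A.domain.zero_mem, by
        have h : A (⟨((0 : K.toSubmodule) : H), A.domain.zero_mem⟩ : A.domain) = 0 := A.map_zero
        rw [h]; exact K.toSubmodule.zero_mem⟩
      add_mem' := by
        rintro v w ⟨hv, hv'⟩ ⟨hw, hw'⟩
        refine ⟨A.domain.add_mem hv hw, ?_⟩
        have h := A.map_add ⟨(v : H), hv⟩ ⟨(w : H), hw⟩
        have h2 := K.toSubmodule.add_mem hv' hw'
        rw [← h] at h2; exact h2
      smul_mem' := by
        rintro c v ⟨hv, hv'⟩
        refine ⟨A.domain.smul_mem c hv, ?_⟩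
        have h := A.map_smul c ⟨(v : H), hv⟩
        have h2 := K.toSubmodule.smul_mem c hv'
        rw [← h] at h2; exact h2 }
  toFun :=
    { toFun := fun v => ⟨A ⟨((v : K.toSubmodule) : H), v.2.choose⟩, v.2.choose_spec⟩
      map_add' := fun v w =>
        Subtype.ext (A.map_add ⟨((v : K.toSubmodule) : H), v.2.choose⟩
          ⟨((w : K.toSubmodule) : H), w.2.choose⟩)
      map_smul' := fun c v =>
        Subtype.ext (A.map_smul c ⟨((v : K.toSubmodule) : H), v.2.choose⟩) }

variable [CompleteSpace H]

/-- The operator `f(A)` for a self-adjoint operator `A` (bounded or not) and a continuous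
compactly supported function `f : ℝ → ℂ`, obtained from the continuous functional calculus of the
Cayley transform of `A`. -/
def applyFun (A : H →ₗ.[ℂ] H) (f : ℝ → ℂ) : H →L[ℂ] H :=
  cfc (onCircle f) A.cayley

/-- The continuous cutoff that is `1` on `[-n, n]`, is `0` off `[-(n+1), n+1]` and is
affine in between. -/
def cutoff (n : ℕ) (x : ℝ) : ℝ := max 0 (min 1 (n + 1 - |x|))

open Classical in
/-- The unitary operator `exp (-i t A)` for a self-adjoint operator `A` (bounded or not): the
strong limit, as `n → ∞`, of `fₙ(A)` with `fₙ(x) = cutoff n x * exp (-i t x)`. -/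
def expNegI (A : H →ₗ.[ℂ] H) (t : ℝ) : H →L[ℂ] H :=
  if h : ∃ T : H →L[ℂ] H, ∀ v : H, Tendsto
      (fun n : ℕ => A.applyFun
        (fun x => (cutoff n x : ℂ) * Complex.exp (-(Complex.I * t * x))) v) atTop (𝓝 (T v))
  then h.choose else 0

/-- The closed orbit of a set `S` of vectors under `A`: the closure of the span of all `f(A) w`
with `w ∈ S` and `f` continuous with compact support. -/
def orbit (A : H →ₗ.[ℂ] H) (S : Set H) : ClosedSubmodule ℂ H :=
  (Submodule.span ℂ {u : H | ∃ f : C_c(ℝ, ℂ), ∃ w ∈ S, u = A.applyFun f w}).closure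

/-- A closed subspace `K` is `A`-invariant if it equals its own orbit under `A`. -/
def IsInvariant (A : H →ₗ.[ℂ] H) (K : ClosedSubmodule ℂ H) : Prop :=
  A.orbit (K : Set H) = K

end Operator

end LinearPMap

instance ClosedSubmodule.instCompleteSpaceToSubmodule {H : Type*} [NormedAddCommGroup H]
    [InnerProductSpace ℂ H] [CompleteSpace H] (K : ClosedSubmodule ℂ H) :
    CompleteSpace K.toSubmodule :=
  K.isClosed.completeSpace_coe

/-- An open linear system `∂ₜ v(t) = -i Ω v(t) - ∫₀^∞ a(τ) v(t - τ) dτ + f(t)` in the Hilbert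
space `E`, given by its frequency operator and its friction function `a(t)`, `t ≥ 0`. -/
structure OpenSystem (E : Type*) [NormedAddCommGroup E] [InnerProductSpace ℂ E] where
  /-- the frequency operator -/
  Ω : E →ₗ.[ℂ] E
  /-- the friction function; only its values at `t ≥ 0` matter -/
  a : ℝ → E →L[ℂ] E

/-- The data of two coupled linear systems
`∂ₜ v₁ = -i Ω₁ v₁ - i Γ v₂ + f₁`, `∂ₜ v₂ = -i Γ† v₁ - i Ω₂ v₂ + f₂`
with bounded coupling operator `Γ : H₂ → H₁`. -/
structure CoupledSystem (H₁ H₂ : Type*) [NormedAddCommGroup H₁] [InnerProductSpace ℂ H₁]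
    [NormedAddCommGroup H₂] [InnerProductSpace ℂ H₂] where
  /-- the frequency operator in the first space -/
  Ω₁ : H₁ →ₗ.[ℂ] H₁
  /-- the frequency operator in the second space -/
  Ω₂ : H₂ →ₗ.[ℂ] H₂
  /-- the coupling operator -/
  Γ : H₂ →L[ℂ] H₁

namespace CoupledSystem

variable {H₁ H₂ : Type*} [NormedAddCommGroup H₁] [InnerProductSpace ℂ H₁] [CompleteSpace H₁]
  [NormedAddCommGroup H₂] [InnerProductSpace ℂ H₂] [CompleteSpace H₂]

/-- The system is conservative: the two frequency operators are (densely defined and)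
self-adjoint. -/
def IsConservative (S : CoupledSystem H₁ H₂) : Prop :=
  IsSelfAdjoint S.Ω₁ ∧ IsSelfAdjoint S.Ω₂

/-- The same system with the roles of the two components exchanged. -/
def swap (S : CoupledSystem H₁ H₂) : CoupledSystem H₂ H₁ where
  Ω₁ := S.Ω₂
  Ω₂ := S.Ω₁
  Γ := S.Γ.adjoint

/-- The frequency operator `Ω = [Ω₁ Γ; Γ† Ω₂]` of the whole system, in the Hilbert space
`H₁ ⊕ H₂`, with domain `Dom Ω₁ ⊕ Dom Ω₂`. -/
def Ω (S : CoupledSystem H₁ H₂) :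
    WithLp 2 (H₁ × H₂) →ₗ.[ℂ] WithLp 2 (H₁ × H₂) where
  domain := S.Ω₁.domain.comap (WithLp.fstₗ 2 ℂ H₁ H₂) ⊓ S.Ω₂.domain.comap (WithLp.sndₗ 2 ℂ H₁ H₂)
  toFun :=
    { toFun := fun x => WithLp.toLp 2
        (S.Ω₁ ⟨x.1.fst, x.2.1⟩ + S.Γ x.1.snd, S.Γ.adjoint x.1.fst + S.Ω₂ ⟨x.1.snd, x.2.2⟩)
      map_add' := by
        intro x y
        have h₁ := S.Ω₁.map_add ⟨x.1.fst, x.2.1⟩ ⟨y.1.fst, y.2.1⟩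
        have h₂ := S.Ω₂.map_add ⟨x.1.snd, x.2.2⟩ ⟨y.1.snd, y.2.2⟩
        rw [← WithLp.toLp_add, Prod.mk_add_mk]
        refine congrArg (WithLp.toLp 2) (Prod.ext ?_ ?_)
        · refine (congrArg₂ (· + ·) h₁ (S.Γ.map_add x.1.snd y.1.snd)).trans ?_
          exact add_add_add_comm _ _ _ _
        · refine (congrArg₂ (· + ·) (S.Γ.adjoint.map_add x.1.fst y.1.fst) h₂).trans ?_
          exact add_add_add_comm _ _ _ _
      map_smul' := by
        intro c x
        have h₁ := S.Ω₁.map_smul c ⟨x.1.fst, x.2.1⟩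
        have h₂ := S.Ω₂.map_smul c ⟨x.1.snd, x.2.2⟩
        rw [RingHom.id_apply, ← WithLp.toLp_smul, Prod.smul_mk]
        refine congrArg (WithLp.toLp 2) (Prod.ext ?_ ?_)
        · refine (congrArg₂ (· + ·) h₁ (S.Γ.map_smul c x.1.snd)).trans ?_
          exact (smul_add _ _ _).symm
        · refine (congrArg₂ (· + ·) (S.Γ.adjoint.map_smul c x.1.fst) h₂).trans ?_
          exact (smul_add _ _ _).symm }

/-- The friction function `a₁(t) = Γ exp(-i t Ω₂) Γ†` of the first open system. -/
def a₁ (S : CoupledSystem H₁ H₂) (t : ℝ) : H₁ →L[ℂ] H₁ :=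
  S.Γ ∘L S.Ω₂.expNegI t ∘L S.Γ.adjoint

/-- The friction function `a₂(t) = Γ† exp(-i t Ω₁) Γ` of the second open system. -/
def a₂ (S : CoupledSystem H₁ H₂) (t : ℝ) : H₂ →L[ℂ] H₂ :=
  S.Γ.adjoint ∘L S.Ω₁.expNegI t ∘L S.Γ

/-- The open system obtained by projecting the dynamics to `H₁`. -/
def openSystem₁ (S : CoupledSystem H₁ H₂) : OpenSystem H₁ := ⟨S.Ω₁, S.a₁⟩

/-- The open system obtained by projecting the dynamics to `H₂`. -/
def openSystem₂ (S : CoupledSystem H₁ H₂) : OpenSystem H₂ := ⟨S.Ω₂, S.a₂⟩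

/-- `T`, with state space `H₁ ⊕ H₂`, is a minimal conservative extension of the open system `O`
in `H₁`: it is conservative, its first component has the internal dynamics and the friction
function of `O`, and the orbit of `Ran Γ†` under the frequency operator of the second component
is all of `H₂`. -/
def IsMinimalConservativeExtension (O : OpenSystem H₁) (T : CoupledSystem H₁ H₂) : Prop :=
  T.IsConservative ∧ T.Ω₁ = O.Ω ∧ (∀ t : ℝ, 0 ≤ t → T.a₁ t = O.a t) ∧
    T.Ω₂.orbit (Set.range T.Γ.adjoint) = ⊤

/-- A system is reconstructible if it is the minimal conservative extension of each of its two
open projected systems. -/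
def IsReconstructible (S : CoupledSystem H₁ H₂) : Prop :=
  IsMinimalConservativeExtension S.openSystem₁ S ∧
    IsMinimalConservativeExtension S.openSystem₂ S.swap

/-- The closed subspace `K₁ ⊕ K₂` of `H₁ ⊕ H₂`. -/
def directSum (K₁ : ClosedSubmodule ℂ H₁) (K₂ : ClosedSubmodule ℂ H₂) :
    ClosedSubmodule ℂ (WithLp 2 (H₁ × H₂)) :=
  K₁.comap (WithLp.fstL 2 ℂ H₁ H₂) ⊓ K₂.comap (WithLp.sndL 2 ℂ H₁ H₂)

/-- The closed subspace `K` of `H₁ ⊕ H₂` is `Ω`-invariant, splits as `K₁ ⊕ K₂` with `Kᵢ` in `Hᵢ`,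
and contains `Ran Γ` (regarded as a subset of `H₁ ⊕ H₂`). -/
def IsSplitInvariantContainingRange (S : CoupledSystem H₁ H₂)
    (K : ClosedSubmodule ℂ (WithLp 2 (H₁ × H₂))) : Prop :=
  S.Ω.IsInvariant K ∧
    (∃ (K₁ : ClosedSubmodule ℂ H₁) (K₂ : ClosedSubmodule ℂ H₂), K = directSum K₁ K₂) ∧
    ∀ w : H₂, WithLp.toLp 2 (S.Γ w, (0 : H₂)) ∈ K

/-- The system on `K₁ ⊕ K₂` with frequency operators `Ω₁ ↾ K₁`, `Ω₂ ↾ K₂` and the coupling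
operator `Γ` compressed to `K₂ → K₁`; if `K₁ ⊕ K₂` is `Ω`-invariant then `Γ` maps `K₂` into `K₁`
and `Γ†` maps `K₁` into `K₂`, so this is the restriction of the system to `K₁ ⊕ K₂`. -/
def subsystem (S : CoupledSystem H₁ H₂) (K₁ : ClosedSubmodule ℂ H₁) (K₂ : ClosedSubmodule ℂ H₂) :
    CoupledSystem K₁.toSubmodule K₂.toSubmodule where
  Ω₁ := S.Ω₁.restrictTo K₁
  Ω₂ := S.Ω₂.restrictTo K₂
  Γ := K₁.toSubmodule.subtypeL.adjoint ∘L S.Γ ∘L K₂.toSubmodule.subtypeL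

/-- The system on `H₁ ⊕ K₂` obtained by restricting the second component to `K₂`. -/
def restrictSnd (S : CoupledSystem H₁ H₂) (K₂ : ClosedSubmodule ℂ H₂) :
    CoupledSystem H₁ K₂.toSubmodule where
  Ω₁ := S.Ω₁
  Ω₂ := S.Ω₂.restrictTo K₂
  Γ := S.Γ ∘L K₂.toSubmodule.subtypeL

/-- The closed subspace `K` of `H₁ ⊕ H₂` is a minimal conservative extension of the first open
system contained in the whole system: `K` is `Ω`-invariant, has the form `H₁ ⊕ K₂`, and the
restriction of the system to `H₁ ⊕ K₂` is a minimal conservative extension of the first open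
system. -/
def IsMinimalExtensionWithin₁ (S : CoupledSystem H₁ H₂)
    (K : ClosedSubmodule ℂ (WithLp 2 (H₁ × H₂))) : Prop :=
  S.Ω.IsInvariant K ∧ ∃ K₂ : ClosedSubmodule ℂ H₂, K = directSum ⊤ K₂ ∧
    IsMinimalConservativeExtension S.openSystem₁ (S.restrictSnd K₂)

/-- The analogue for the second open system and subspaces of the form `K₁ ⊕ H₂`. -/
def IsMinimalExtensionWithin₂ (S : CoupledSystem H₁ H₂)
    (K : ClosedSubmodule ℂ (WithLp 2 (H₁ × H₂))) : Prop :=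
  S.Ω.IsInvariant K ∧ ∃ K₁ : ClosedSubmodule ℂ H₁, K = directSum K₁ ⊤ ∧
    IsMinimalConservativeExtension S.openSystem₂ (S.swap.restrictSnd K₁)

/-- The subsystem on `K₁ ⊕ K₂` determines `a₁`: on `K₁`, `a₁` is the friction function of the
subsystem, and `a₁` vanishes on `H₁ ⊖ K₁`. -/
def Determines₁ (S : CoupledSystem H₁ H₂) (K₁ : ClosedSubmodule ℂ H₁)
    (K₂ : ClosedSubmodule ℂ H₂) : Prop :=
  ∀ t : ℝ, 0 ≤ t →
    (∀ v : K₁.toSubmodule, S.a₁ t v = ((S.subsystem K₁ K₂).a₁ t v : K₁.toSubmodule)) ∧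
    ∀ v ∈ K₁.toSubmoduleᗮ, S.a₁ t v = 0

/-- The subsystem on `K₁ ⊕ K₂` determines `a₂`: on `K₂`, `a₂` is the friction function of the
subsystem, and `a₂` vanishes on `H₂ ⊖ K₂`. -/
def Determines₂ (S : CoupledSystem H₁ H₂) (K₁ : ClosedSubmodule ℂ H₁)
    (K₂ : ClosedSubmodule ℂ H₂) : Prop :=
  ∀ t : ℝ, 0 ≤ t →
    (∀ v : K₂.toSubmodule, S.a₂ t v = ((S.subsystem K₁ K₂).a₂ t v : K₂.toSubmodule)) ∧
    ∀ v ∈ K₂.toSubmoduleᗮ, S.a₂ t v = 0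

end CoupledSystem

end

/-!
A bounded operator intertwines two self-adjoint operators if and only if it intertwines their
resolvents at `-i`; by Stone–Weierstrass it then intertwines `f(A)` for every `f ∈ C₀(ℝ)`, and by
strong limits the unitary groups. Hence a closed subspace is `A`-invariant if and only if its
orthogonal projection intertwines `A` with itself, a condition on the graph of `A` alone.

For the block operator `Ω` this says that `K₁ ⊕ K₂` is `Ω`-invariant if and only if each `Kᵢ` is
`Ωᵢ`-invariant, `Γ K₂ ⊆ K₁` and `Γ† K₁ ⊆ K₂`. If moreover `Ran Γ ⊆ K₁`, then `Γ†` vanishes on the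
orthogonal complement of `K₁`, so that `Ran Γ† ⊆ K₂`: the orbits of `Ran Γ` and `Ran Γ†` are the
summands of the smallest such subspace. The condition `Ran Γ ⊆ K₁` is forced when `K₁ ⊕ K₂`
determines `a₁`, because `a₁(0) = Γ Γ†`. Finally, `K₁ ⊕ 0` is `Ω`-invariant if and only if `K₁` is
`Ω₁`-invariant and orthogonal to the orbit of `Ran Γ`.
-/

namespace UnboundedOperator

open scoped ZeroAtInfty
open LinearPMap (IsResolventAtNegI onCircle cutoff isSelfAdjoint_def eq_of_eq_graph
  adjoint_graph_eq_graph_adjoint mem_graph_iff mem_domain_of_mem_graph)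

section SelfAdjoint

variable {H : Type*} [NormedAddCommGroup H] [InnerProductSpace ℂ H]

/-- The operator `A - z`, as a bounded operator on the graph of `A`: it maps `(x, A x)` to
`A x - z x`. -/
def graphSub (A : H →ₗ.[ℂ] H) (z : ℂ) : A.graph →L[ℂ] H :=
  (ContinuousLinearMap.snd ℂ H H - z • ContinuousLinearMap.fst ℂ H H) ∘L A.graph.subtypeL

theorem graphSub_apply (A : H →ₗ.[ℂ] H) (z : ℂ) (g : A.graph) :
    graphSub A z g = g.1.2 - z • g.1.1 := rfl

variable [CompleteSpace H] {A : H →ₗ.[ℂ] H}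

theorem isSelfAdjoint_iff_graph (A : H →ₗ.[ℂ] H) :
    IsSelfAdjoint A ↔ Dense (A.domain : Set H) ∧ ∀ x w : H, (x, w) ∈ A.graph ↔
      ∀ y z : H, (y, z) ∈ A.graph → inner ℂ z x = inner ℂ y w := by
  have mem_graph_adjoint_iff (hd : Dense (A.domain : Set H)) (x w : H) :
      (x, w) ∈ A.adjoint.graph ↔ ∀ y z : H, (y, z) ∈ A.graph → inner ℂ z x = inner ℂ y w := by
    rw [adjoint_graph_eq_graph_adjoint hd, Submodule.mem_adjoint_iff]
    simp only [sub_eq_zero]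
  constructor
  · intro hA
    refine ⟨hA.dense_domain, fun x w => ?_⟩
    rw [← mem_graph_adjoint_iff hA.dense_domain, isSelfAdjoint_def.1 hA]
  · rintro ⟨hd, hgraph⟩
    refine isSelfAdjoint_def.2 (eq_of_eq_graph ?_)
    ext ⟨x, w⟩
    rw [mem_graph_adjoint_iff hd, hgraph]

theorem inner_eq_of_mem_graph (hA : IsSelfAdjoint A) {x w y z : H} (hxw : (x, w) ∈ A.graph)
    (hyz : (y, z) ∈ A.graph) : inner ℂ z x = inner ℂ y w :=
  (((isSelfAdjoint_iff_graph A).1 hA).2 x w).1 hxw y z hyz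

theorem mem_graph_of_inner_eq (hA : IsSelfAdjoint A) {x w : H}
    (h : ∀ y z : H, (y, z) ∈ A.graph → inner ℂ z x = inner ℂ y w) : (x, w) ∈ A.graph :=
  (((isSelfAdjoint_iff_graph A).1 hA).2 x w).2 h

theorem im_inner_eq_zero_of_mem_graph (hA : IsSelfAdjoint A) {x y : H} (h : (x, y) ∈ A.graph) :
    (inner ℂ y x).im = 0 := by
  have him := congrArg Complex.im (inner_eq_of_mem_graph hA h h)
  rw [← inner_conj_symm x y, Complex.conj_im] at him
  linarith

theorem norm_sub_smul_sq_of_mem_graph (hA : IsSelfAdjoint A) {x y : H} (h : (x, y) ∈ A.graph)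
    (z : ℂ) : ‖y - z • x‖ ^ 2 = ‖y - z.re • x‖ ^ 2 + z.im ^ 2 * ‖x‖ ^ 2 := by
  rw [← Complex.coe_smul z.re x, norm_sub_sq (𝕜 := ℂ), norm_sub_sq (𝕜 := ℂ), norm_smul,
    norm_smul, inner_smul_right, inner_smul_right, mul_pow, mul_pow, Complex.sq_norm,
    Complex.normSq_apply, Complex.norm_real, Real.norm_eq_abs, sq_abs]
  simp only [RCLike.re_eq_complex_re, Complex.mul_re, im_inner_eq_zero_of_mem_graph hA h,
    Complex.ofReal_re, Complex.ofReal_im]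
  ring

theorem abs_im_mul_norm_le_of_mem_graph (hA : IsSelfAdjoint A) {x y : H} (h : (x, y) ∈ A.graph)
    (z : ℂ) : |z.im| * ‖x‖ ≤ ‖y - z • x‖ := by
  refine le_of_sq_le_sq ?_ (norm_nonneg _)
  rw [norm_sub_smul_sq_of_mem_graph hA h, mul_pow, sq_abs]
  exact le_add_of_nonneg_left (sq_nonneg _)

theorem antilipschitzWith_graphSub (hA : IsSelfAdjoint A) {z : ℂ} (hz : z.im ≠ 0) :
    ∃ C, AntilipschitzWith C (graphSub A z) := by
  refine ⟨⟨1 + (‖z‖ + 1) / |z.im|, by positivity⟩,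
    AddMonoidHomClass.antilipschitz_of_bound _ fun g => ?_⟩
  obtain ⟨⟨x, y⟩, hg⟩ := g
  have hx : ‖x‖ ≤ ‖y - z • x‖ / |z.im| := by
    rw [le_div_iff₀' (abs_pos.2 hz)]
    exact abs_im_mul_norm_le_of_mem_graph hA hg z
  have hy : ‖y‖ ≤ ‖y - z • x‖ + ‖z‖ * ‖x‖ := by
    simpa [norm_smul] using norm_add_le (y - z • x) (z • x)
  calc max ‖x‖ ‖y‖ ≤ ‖y - z • x‖ + (‖z‖ + 1) * ‖x‖ := by
        have := mul_nonneg (norm_nonneg z) (norm_nonneg x)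
        refine max_le ?_ ?_ <;> linarith [norm_nonneg x, norm_nonneg (y - z • x)]
    _ ≤ ‖y - z • x‖ + (‖z‖ + 1) * (‖y - z • x‖ / |z.im|) := by gcongr
    _ = (1 + (‖z‖ + 1) / |z.im|) * ‖y - z • x‖ := by ring

theorem range_graphSub (hA : IsSelfAdjoint A) {z : ℂ} (hz : z.im ≠ 0) :
    (graphSub A z).range = ⊤ := by
  have hgraph : IsClosed (A.graph : Set (H × H)) := hA.isClosed
  have : CompleteSpace A.graph := hgraph.completeSpace_coe
  obtain ⟨C, hC⟩ := antilipschitzWith_graphSub hA hz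
  have hrange : IsClosed ((graphSub A z).range : Set H) :=
    hC.isClosed_range (graphSub A z).uniformContinuous
  have : CompleteSpace (graphSub A z).range := hrange.completeSpace_coe
  rw [← Submodule.orthogonal_eq_bot_iff, Submodule.eq_bot_iff]
  intro x hx
  have hmem : (x, (starRingEnd ℂ) z • x) ∈ A.graph := by
    refine mem_graph_of_inner_eq hA fun u v huv => ?_
    have horth := (Submodule.mem_orthogonal _ _).1 hx _ ⟨⟨(u, v), huv⟩, rfl⟩
    rw [ContinuousLinearMap.coe_coe, graphSub_apply, inner_sub_left, inner_smul_left,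
      sub_eq_zero] at horth
    rw [inner_smul_right, horth]
  have hnorm := abs_im_mul_norm_le_of_mem_graph hA hmem ((starRingEnd ℂ) z)
  rw [sub_self, norm_zero, Complex.conj_im, abs_neg] at hnorm
  exact norm_le_zero_iff.1 (nonpos_of_mul_nonpos_right hnorm (abs_pos.2 hz))

theorem exists_isResolventAtNegI (hA : IsSelfAdjoint A) :
    ∃ R : H →L[ℂ] H, IsResolventAtNegI A R := by
  have hz : (-Complex.I).im ≠ 0 := by simp
  have hgraph : IsClosed (A.graph : Set (H × H)) := hA.isClosed
  have : CompleteSpace A.graph := hgraph.completeSpace_coe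
  obtain ⟨C, hC⟩ := antilipschitzWith_graphSub hA hz
  let e := ContinuousLinearEquiv.ofBijective (graphSub A (-Complex.I))
    (LinearMap.ker_eq_bot.2 hC.injective) (range_graphSub hA hz)
  refine ⟨ContinuousLinearMap.fst ℂ H H ∘L A.graph.subtypeL ∘L (e.symm : H →L[ℂ] A.graph),
    fun v => ?_⟩
  obtain ⟨⟨x, hx⟩, hAx⟩ := (mem_graph_iff _).1 (e.symm v).2
  have hev : (e.symm v).1.2 - -Complex.I • (e.symm v).1.1 = v := e.apply_symm_apply v
  rw [← hAx.1, ← hAx.2, neg_smul, sub_neg_eq_add] at hev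
  simp only [ContinuousLinearMap.comp_apply, ContinuousLinearEquiv.coe_coe,
    Submodule.subtypeL_apply, ContinuousLinearMap.coe_fst', ← hAx.1]
  exact ⟨hx, hev⟩

theorem resolventAtNegI_mem_graph (hA : IsSelfAdjoint A) (v : H) :
    (A.resolventAtNegI v, v - Complex.I • A.resolventAtNegI v) ∈ A.graph := by
  have hex := exists_isResolventAtNegI hA
  have hR : IsResolventAtNegI A A.resolventAtNegI := by
    rw [LinearPMap.resolventAtNegI, dif_pos hex]
    exact hex.choose_spec
  obtain ⟨hdom, heq⟩ := hR v
  exact (mem_graph_iff _).2 ⟨⟨_, hdom⟩, rfl, eq_sub_of_add_eq heq⟩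

theorem resolventAtNegI_apply (hA : IsSelfAdjoint A) {x y : H} (h : (x, y) ∈ A.graph) :
    A.resolventAtNegI (y + Complex.I • x) = x := by
  have hmem := A.graph.sub_mem (resolventAtNegI_mem_graph hA (y + Complex.I • x)) h
  have hle := abs_im_mul_norm_le_of_mem_graph hA hmem (-Complex.I)
  have hzero : (y + Complex.I • x - Complex.I • A.resolventAtNegI (y + Complex.I • x) - y) -
      -Complex.I • (A.resolventAtNegI (y + Complex.I • x) - x) = 0 := by module
  rw [hzero] at hle
  simpa [sub_eq_zero] using hle

theorem denseRange_resolventAtNegI (hA : IsSelfAdjoint A) : DenseRange A.resolventAtNegI :=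
  hA.dense_domain.mono fun x hx => ⟨_, resolventAtNegI_apply hA (A.mem_graph ⟨x, hx⟩)⟩

theorem cayley_apply (hA : IsSelfAdjoint A) {x y : H} (h : (x, y) ∈ A.graph) :
    A.cayley (y + Complex.I • x) = y - Complex.I • x := by
  rw [LinearPMap.cayley, sub_apply, smul_apply, resolventAtNegI_apply hA h, one_apply_eq_self]
  module

theorem norm_cayley_apply (hA : IsSelfAdjoint A) (v : H) : ‖A.cayley v‖ = ‖v‖ := by
  obtain ⟨⟨⟨x, y⟩, h⟩, rfl⟩ : ∃ g, graphSub A (-Complex.I) g = v :=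
    LinearMap.range_eq_top.1 (range_graphSub hA (by simp)) v
  have hneg : graphSub A (-Complex.I) ⟨(x, y), h⟩ = y + Complex.I • x := by
    rw [graphSub_apply, neg_smul, sub_neg_eq_add]
  have hsub := norm_sub_smul_sq_of_mem_graph hA h Complex.I
  have hadd := norm_sub_smul_sq_of_mem_graph hA h (-Complex.I)
  rw [neg_smul, sub_neg_eq_add] at hadd
  rw [hneg, cayley_apply hA h, ← sq_eq_sq₀ (norm_nonneg _) (norm_nonneg _), hsub, hadd]
  simp

theorem surjective_cayley (hA : IsSelfAdjoint A) : Function.Surjective A.cayley := by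
  intro v
  obtain ⟨⟨⟨x, y⟩, h⟩, rfl⟩ : ∃ g, graphSub A Complex.I g = v :=
    LinearMap.range_eq_top.1 (range_graphSub hA (by simp)) v
  exact ⟨_, cayley_apply hA h⟩

theorem cayley_mem_unitary (hA : IsSelfAdjoint A) : A.cayley ∈ unitary (H →L[ℂ] H) :=
  (Unitary.linearIsometryEquiv.symm (LinearIsometryEquiv.ofSurjective
    ⟨A.cayley.toLinearMap, norm_cayley_apply hA⟩ (surjective_cayley hA))).2

theorem spectrum_cayley_subset (hA : IsSelfAdjoint A) :
    spectrum ℂ A.cayley ⊆ Metric.sphere 0 1 :=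
  spectrum.subset_circle_of_unitary (cayley_mem_unitary hA)

end SelfAdjoint

section Intertwines

variable {H K : Type*} [NormedAddCommGroup H] [InnerProductSpace ℂ H]
  [NormedAddCommGroup K] [InnerProductSpace ℂ K]

/-- The bounded operator `V` intertwines `B` with `A`: it maps `Dom B` into `Dom A` and
`A V = V B` on `Dom B`. -/
def Intertwines (B : K →ₗ.[ℂ] K) (A : H →ₗ.[ℂ] H) (V : K →L[ℂ] H) : Prop :=
  ∀ x y : K, (x, y) ∈ B.graph → (V x, V y) ∈ A.graph

variable [CompleteSpace H] [CompleteSpace K] {A : H →ₗ.[ℂ] H} {B : K →ₗ.[ℂ] K} {V : K →L[ℂ] H}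

theorem intertwines_iff_resolventAtNegI_comp (hA : IsSelfAdjoint A) (hB : IsSelfAdjoint B) :
    Intertwines B A V ↔ A.resolventAtNegI ∘L V = V ∘L B.resolventAtNegI := by
  constructor
  · intro hV
    ext v
    simpa using resolventAtNegI_apply hA (hV _ _ (resolventAtNegI_mem_graph hB v))
  · intro hR x y hxy
    have hVx : A.resolventAtNegI (V (y + Complex.I • x)) = V x := by
      rw [← ContinuousLinearMap.comp_apply, hR, ContinuousLinearMap.comp_apply,
        resolventAtNegI_apply hB hxy]
    have hmem := resolventAtNegI_mem_graph hA (V (y + Complex.I • x))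
    rwa [hVx, map_add, map_smul, add_sub_cancel_right] at hmem

theorem Intertwines.cayley_comp (hV : Intertwines B A V) (hA : IsSelfAdjoint A)
    (hB : IsSelfAdjoint B) : A.cayley ∘L V = V ∘L B.cayley := by
  ext v
  have hR := DFunLike.congr_fun ((intertwines_iff_resolventAtNegI_comp hA hB).1 hV) v
  simp only [ContinuousLinearMap.comp_apply] at hR
  simp [LinearPMap.cayley, hR]

end Intertwines

section Intertwining

variable {H K : Type*} [NormedAddCommGroup H] [InnerProductSpace ℂ H] [CompleteSpace H]
  [NormedAddCommGroup K] [InnerProductSpace ℂ K] [CompleteSpace K] {V : K →L[ℂ] H}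

theorem starAlgHom_comp_eq_comp {s : Set ℂ} [CompactSpace s] {φ : C(s, ℂ) →⋆ₐ[ℂ] (H →L[ℂ] H)}
    {ψ : C(s, ℂ) →⋆ₐ[ℂ] (K →L[ℂ] K)}
    (hid : φ (.restrict s (.id ℂ)) ∘L V = V ∘L ψ (.restrict s (.id ℂ)))
    (hstar : φ (star (.restrict s (.id ℂ))) ∘L V = V ∘L ψ (star (.restrict s (.id ℂ))))
    (f : C(s, ℂ)) : φ f ∘L V = V ∘L ψ f := by
  open CStarAlgebra in
  have hφ : Continuous φ := map_continuous φ
  have hψ : Continuous ψ := map_continuous ψ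
  induction f using ContinuousMap.induction_on_of_compact with
  | const r =>
    have hφr : φ (.const _ r) = algebraMap ℂ _ r := AlgHomClass.commutes φ r
    have hψr : ψ (.const _ r) = algebraMap ℂ _ r := AlgHomClass.commutes ψ r
    ext v
    simp [hφr, hψr, Algebra.algebraMap_eq_smul_one]
  | id => exact hid
  | star_id => exact hstar
  | add f g hf hg =>
    rw [map_add, map_add, ContinuousLinearMap.add_comp, ContinuousLinearMap.comp_add, hf, hg]
  | mul f g hf hg =>
    calc φ (f * g) ∘L V = φ f ∘L φ g ∘L V := by rw [map_mul]; rfl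
      _ = (φ f ∘L V) ∘L ψ g := by rw [hg]; rfl
      _ = V ∘L ψ (f * g) := by rw [hf, map_mul]; rfl
  | frequently f hf =>
    exact hf.mem_of_closed (isClosed_eq (by fun_prop) (by fun_prop))

theorem cfc_comp_eq_comp_cfc {a : H →L[ℂ] H} {b : K →L[ℂ] K} (ha : IsStarNormal a)
    (hb : IsStarNormal b) (hab : a ∘L V = V ∘L b) (hstar : star a ∘L V = V ∘L star b) {g : ℂ → ℂ}
    (hg : ContinuousOn g (spectrum ℂ a ∪ spectrum ℂ b)) : cfc g a ∘L V = V ∘L cfc g b := by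
  set s := spectrum ℂ a ∪ spectrum ℂ b
  have : CompactSpace s := isCompact_iff_compactSpace.1
    ((spectrum.isCompact a).union (spectrum.isCompact b))
  let φ : C(s, ℂ) →⋆ₐ[ℂ] (H →L[ℂ] H) := (cfcHom ha).comp (ContinuousMap.compStarAlgHom' ℂ ℂ
    ⟨Set.inclusion Set.subset_union_left, continuous_inclusion _⟩)
  let ψ : C(s, ℂ) →⋆ₐ[ℂ] (K →L[ℂ] K) := (cfcHom hb).comp (ContinuousMap.compStarAlgHom' ℂ ℂ
    ⟨Set.inclusion Set.subset_union_right, continuous_inclusion _⟩)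
  have hφ : φ (.restrict s (.id ℂ)) = a := cfcHom_id ha
  have hψ : ψ (.restrict s (.id ℂ)) = b := cfcHom_id hb
  rw [cfc_apply g a ha (hg.mono Set.subset_union_left),
    cfc_apply g b hb (hg.mono Set.subset_union_right)]
  refine starAlgHom_comp_eq_comp (φ := φ) (ψ := ψ) ?_ ?_
    ⟨fun z => g z, continuousOn_iff_continuous_domRestrict.1 hg⟩
  · rw [hφ, hψ, hab]
  · rw [map_star, map_star, hφ, hψ, hstar]

theorem star_comp_eq_comp_star_of_mem_unitary {a : H →L[ℂ] H} {b : K →L[ℂ] K}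
    (ha : a ∈ unitary (H →L[ℂ] H)) (hb : b ∈ unitary (K →L[ℂ] K)) (hab : a ∘L V = V ∘L b) :
    star a ∘L V = V ∘L star b := by
  calc star a ∘L V = star a ∘L (V ∘L b) ∘L star b := by
        rw [ContinuousLinearMap.comp_assoc V, ← ContinuousLinearMap.mul_def b,
          (Unitary.mem_iff.1 hb).2]
        rfl
    _ = (star a * a) ∘L V ∘L star b := by rw [← hab]; rfl
    _ = V ∘L star b := by rw [(Unitary.mem_iff.1 ha).1]; rfl

end Intertwining

section InverseCayley

theorem inverseCayley_ofReal_re {z : ℂ} (hz : ‖z‖ = 1) :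
    (((Complex.I * (1 + z) / (1 - z)).re : ℝ) : ℂ) = Complex.I * (1 + z) / (1 - z) := by
  by_cases hz1 : z = 1
  · simp [hz1]
  have hz0 : z ≠ 0 := by rintro rfl; simp at hz
  have hsub : 1 - z ≠ 0 := sub_ne_zero.2 (Ne.symm hz1)
  have hsub_inv : 1 - z⁻¹ ≠ 0 := sub_ne_zero.2 fun h => hz1 (inv_eq_one.1 h.symm)
  have hconj : (starRingEnd ℂ) z = z⁻¹ := by
    rw [Complex.inv_def, Complex.normSq_eq_norm_sq, hz]; simp
  rw [← Complex.conj_eq_iff_re, map_div₀, map_mul, map_add, map_sub, map_one, hconj,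
    Complex.conj_I, div_eq_div_iff hsub_inv hsub]
  field_simp
  ring

theorem inverseCayley_add_I_inv {z : ℂ} (hz : ‖z‖ = 1) (hz1 : z ≠ 1) :
    ((((Complex.I * (1 + z) / (1 - z)).re : ℝ) : ℂ) + Complex.I)⁻¹ =
      (1 - z) / (2 * Complex.I) := by
  have hsub : 1 - z ≠ 0 := sub_ne_zero.2 (Ne.symm hz1)
  rw [inverseCayley_ofReal_re hz, ← inv_div]
  field_simp
  ring

theorem tendsto_inverseCayley :
    Tendsto (fun z : ℂ => (Complex.I * (1 + z) / (1 - z)).re)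
      (𝓝[Metric.sphere 0 1 \ {1}] 1) (cocompact ℝ) := by
  have htendsto : Tendsto (fun z : ℂ => (1 - z) / (2 * Complex.I)) (𝓝[Metric.sphere 0 1 \ {1}] 1)
      (𝓝[≠] 0) := by
    refine tendsto_nhdsWithin_iff.2 ⟨tendsto_nhdsWithin_of_tendsto_nhds ?_, ?_⟩
    · exact Continuous.tendsto' (by fun_prop) _ _ (by simp)
    · filter_upwards [self_mem_nhdsWithin] with z hz
      exact div_ne_zero (sub_ne_zero.2 (Ne.symm hz.2)) (by simp)
  have hnorm := (tendsto_norm_cobounded_atTop (E := ℂ)).comp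
    (tendsto_inv₀_nhdsNE_zero.comp htendsto)
  rw [← Metric.cobounded_eq_cocompact, ← tendsto_norm_atTop_iff_cobounded]
  refine tendsto_atTop_mono' _ ?_ (tendsto_atTop_add_const_right _ (-1) hnorm)
  filter_upwards [self_mem_nhdsWithin] with z hz
  rw [Function.comp_apply, Function.comp_apply,
    ← inverseCayley_add_I_inv (by simpa using hz.1) hz.2, inv_inv]
  refine (add_le_add_left (norm_add_le _ _) _).trans ?_
  simp

theorem continuousOn_onCircle (f : C₀(ℝ, ℂ)) : ContinuousOn (onCircle f) (Metric.sphere 0 1) := by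
  intro z hz
  have honCircle {w : ℂ} (hw : w ≠ 1) : f (Complex.I * (1 + w) / (1 - w)).re = onCircle f w :=
    (if_neg hw).symm
  by_cases hz1 : z = 1
  · subst hz1
    rw [← continuousWithinAt_sdiff_self, ContinuousWithinAt, onCircle, if_pos rfl]
    refine ((zero_at_infty f).comp tendsto_inverseCayley).congr' ?_
    filter_upwards [self_mem_nhdsWithin] with w hw using honCircle hw.2
  · have hsub : 1 - z ≠ 0 := sub_ne_zero.2 (Ne.symm hz1)
    have hcont : ContinuousAt (fun w : ℂ => f (Complex.I * (1 + w) / (1 - w)).re) z := by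
      fun_prop (disch := assumption)
    refine (hcont.congr ?_).continuousWithinAt
    filter_upwards [isOpen_ne.mem_nhds hz1] with w hw using honCircle hw

end InverseCayley

section FunctionalCalculus

variable {H : Type*} [NormedAddCommGroup H] [InnerProductSpace ℂ H] [CompleteSpace H]
  {A : H →ₗ.[ℂ] H}

/-- The functional calculus of a self-adjoint operator `A` for continuous functions vanishing at
infinity, as a homomorphism of star algebras. -/
noncomputable def applyFunHom (hA : IsSelfAdjoint A) : C₀(ℝ, ℂ) →⋆ₙₐ[ℂ] (H →L[ℂ] H) where
  toFun f := A.applyFun f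
  map_zero' := by
    have h : onCircle (0 : C₀(ℝ, ℂ)) = fun _ => 0 := by
      ext z; simp [onCircle]
    rw [LinearPMap.applyFun, h, cfc_const_zero]
  map_smul' c f := by
    have h : onCircle (c • f : C₀(ℝ, ℂ)) = fun z => c • onCircle f z := by
      ext z; simp [onCircle]
    rw [LinearPMap.applyFun, h, cfc_smul _ _ _
      ((continuousOn_onCircle f).mono (spectrum_cayley_subset hA))]
    rfl
  map_add' f g := by
    have h : onCircle (f + g : C₀(ℝ, ℂ)) = fun z => onCircle f z + onCircle g z := by
      ext z; by_cases hz : z = 1 <;> simp [onCircle, hz]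
    exact (congrArg (cfc · A.cayley) h).trans
      (cfc_add _ _ _ ((continuousOn_onCircle f).mono (spectrum_cayley_subset hA))
        ((continuousOn_onCircle g).mono (spectrum_cayley_subset hA)))
  map_mul' f g := by
    have h : onCircle (f * g : C₀(ℝ, ℂ)) = fun z => onCircle f z * onCircle g z := by
      ext z; by_cases hz : z = 1 <;> simp [onCircle, hz]
    exact (congrArg (cfc · A.cayley) h).trans
      (cfc_mul _ _ _ ((continuousOn_onCircle f).mono (spectrum_cayley_subset hA))
        ((continuousOn_onCircle g).mono (spectrum_cayley_subset hA)))
  map_star' f := by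
    have h : onCircle (star f : C₀(ℝ, ℂ)) = fun z => star (onCircle f z) := by
      ext z; by_cases hz : z = 1 <;> simp [onCircle, hz]
    rw [LinearPMap.applyFun, h, cfc_star]
    rfl

theorem continuous_applyFunHom (hA : IsSelfAdjoint A) : Continuous (applyFunHom hA) := by
  open CStarAlgebra in exact map_continuous (applyFunHom hA)

/-- The function `x ↦ (x + i)⁻¹`, for which `f(A)` is the resolvent. -/
noncomputable def resolventFun : C₀(ℝ, ℂ) where
  toFun x := ((x : ℂ) + Complex.I)⁻¹
  continuous_toFun := Continuous.inv₀ (by fun_prop) fun x hx => by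
    simpa using congrArg Complex.im hx
  zero_at_infty' := by
    have hisometry : Isometry fun x : ℝ => (x : ℂ) + Complex.I :=
      (IsometryEquiv.addRight Complex.I).isometry.comp Complex.isometry_ofReal
    rw [← Metric.cobounded_eq_cocompact]
    exact tendsto_inv₀_cobounded.comp hisometry.antilipschitz.tendsto_cobounded

theorem applyFun_resolventFun (hA : IsSelfAdjoint A) :
    A.applyFun resolventFun = A.resolventAtNegI := by
  have := isStarNormal_of_mem_unitary (cayley_mem_unitary hA)
  have hlinear : A.applyFun resolventFun =
      cfc (fun z : ℂ => (2 * Complex.I)⁻¹ * (1 - z)) A.cayley := by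
    refine cfc_congr fun z hz => ?_
    by_cases hz1 : z = 1
    · simp [onCircle, hz1]
    · rw [onCircle, if_neg hz1, inv_mul_eq_div]
      exact inverseCayley_add_I_inv (by simpa using spectrum_cayley_subset hA hz) hz1
  rw [hlinear, cfc_const_mul _ _ _, cfc_sub _ _ _, cfc_const_one _ _, cfc_id' _ _,
    LinearPMap.cayley, sub_sub_cancel, smul_smul, inv_mul_cancel₀ (by simp), one_smul]

theorem Intertwines.applyFun_apply {K : Type*} [NormedAddCommGroup K] [InnerProductSpace ℂ K]
    [CompleteSpace K] {B : K →ₗ.[ℂ] K} {V : K →L[ℂ] H} (hV : Intertwines B A V)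
    (hA : IsSelfAdjoint A) (hB : IsSelfAdjoint B) (f : C₀(ℝ, ℂ)) (v : K) :
    A.applyFun f (V v) = V (B.applyFun f v) :=
  have hUA := cayley_mem_unitary hA
  have hUB := cayley_mem_unitary hB
  have hU := hV.cayley_comp hA hB
  DFunLike.congr_fun (cfc_comp_eq_comp_cfc (isStarNormal_of_mem_unitary hUA)
    (isStarNormal_of_mem_unitary hUB) hU (star_comp_eq_comp_star_of_mem_unitary hUA hUB hU)
    ((continuousOn_onCircle f).mono
      (Set.union_subset (spectrum_cayley_subset hA) (spectrum_cayley_subset hB)))) v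

end FunctionalCalculus

section StrongLimit

variable {E F : Type*} [NormedAddCommGroup E] [NormedSpace ℂ E] [NormedAddCommGroup F]
  [NormedSpace ℂ F] {T : ℕ → E →L[ℂ] F} {C : ℝ}

theorem cauchySeq_apply_of_mem_closure (hT : ∀ n v, ‖T n v‖ ≤ C * ‖v‖) {D : Set E} {v : E}
    (hv : v ∈ closure D) (hD : ∀ w ∈ D, CauchySeq fun n => T n w) : CauchySeq fun n => T n v := by
  rw [Metric.cauchySeq_iff']
  intro ε hε
  have hclose : Tendsto (fun w => C * ‖v - w‖) (𝓝 v) (𝓝 0) :=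
    Continuous.tendsto' (by fun_prop) _ _ (by simp)
  obtain ⟨w, hw, hwD⟩ := mem_closure_iff_nhds.1 hv _
    (hclose.eventually_lt_const (show 0 < ε / 3 by positivity))
  have hdist (n : ℕ) : dist (T n v) (T n w) < ε / 3 := by
    rw [dist_eq_norm, ← map_sub]
    exact (hT n _).trans_lt hw
  obtain ⟨N, hN⟩ := Metric.cauchySeq_iff'.1 (hD w hwD) (ε / 3) (by positivity)
  refine ⟨N, fun n hn => ?_⟩
  linarith [dist_triangle4_right (T n v) (T N v) (T n w) (T N w), hdist n, hdist N, hN n hn]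

theorem exists_tendsto_apply_of_dense [CompleteSpace E] [CompleteSpace F]
    (hT : ∀ n v, ‖T n v‖ ≤ C * ‖v‖) {D : Set E} (hdense : Dense D)
    (hD : ∀ w ∈ D, CauchySeq fun n => T n w) :
    ∃ L : E →L[ℂ] F, ∀ v, Tendsto (fun n => T n v) atTop (𝓝 (L v)) := by
  choose L hL using fun v => cauchySeq_tendsto_of_complete
    (cauchySeq_apply_of_mem_closure hT (hdense v) hD)
  exact ⟨continuousLinearMapOfTendsto T (tendsto_pi_nhds.2 hL), hL⟩

end StrongLimit

section Cutoff

theorem cutoff_eq_one {n : ℕ} {x : ℝ} (h : |x| ≤ n) : cutoff n x = 1 := by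
  rw [cutoff, min_eq_left (by linarith), max_eq_right zero_le_one]

theorem cutoff_eq_zero {n : ℕ} {x : ℝ} (h : n + 1 ≤ |x|) : cutoff n x = 0 :=
  max_eq_left ((min_le_right _ _).trans (by linarith))

theorem cutoff_mem_Icc (n : ℕ) (x : ℝ) : cutoff n x ∈ Set.Icc 0 1 :=
  ⟨le_max_left _ _, max_le zero_le_one (min_le_left _ _)⟩

/-- The cutoff function `cutoff n`, as a complex-valued compactly supported continuous function. -/
noncomputable def compactCutoff (n : ℕ) : C_c(ℝ, ℂ) where
  toFun x := cutoff n x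
  continuous_toFun := by unfold cutoff; fun_prop
  hasCompactSupport' := by
    refine HasCompactSupport.intro (isCompact_closedBall 0 (n + 1 : ℝ)) fun x hx => ?_
    rw [Metric.mem_closedBall, dist_zero_right, Real.norm_eq_abs, not_le] at hx
    rw [cutoff_eq_zero hx.le, Complex.ofReal_zero]

theorem compactCutoff_apply (n : ℕ) (x : ℝ) : compactCutoff n x = cutoff n x := rfl

theorem norm_compactCutoff_le (n : ℕ) (x : ℝ) : ‖compactCutoff n x‖ ≤ 1 := by
  rw [compactCutoff_apply, Complex.norm_real, Real.norm_of_nonneg (cutoff_mem_Icc n x).1]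
  exact (cutoff_mem_Icc n x).2

theorem norm_one_sub_compactCutoff_le (n : ℕ) (x : ℝ) : ‖1 - compactCutoff n x‖ ≤ 1 := by
  have h := Set.Icc.mem_iff_one_sub_mem.1 (cutoff_mem_Icc n x)
  rw [compactCutoff_apply, ← Complex.ofReal_one, ← Complex.ofReal_sub, Complex.norm_real,
    Real.norm_of_nonneg h.1]
  exact h.2

theorem eventually_forall_abs_le_of_mem_cocompact {s : Set ℝ} (hs : s ∈ cocompact ℝ) :
    ∀ᶠ n : ℕ in atTop, ∀ x ∉ s, |x| ≤ n := by
  obtain ⟨r, hr⟩ := (Metric.mem_cocompact_iff_closedBall_compl_subset 0).1 hs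
  filter_upwards [eventually_ge_atTop ⌈r⌉₊] with n hn x hx
  have hxr : |x| ≤ r := by
    rw [← Real.norm_eq_abs, ← dist_zero_right]
    by_contra h
    exact hx (hr h)
  exact hxr.trans (Nat.ceil_le.1 hn)

theorem tendsto_smul_compactCutoff (f : C₀(ℝ, ℂ)) :
    Tendsto (fun n => ((f • compactCutoff n : C_c(ℝ, ℂ)) : C₀(ℝ, ℂ))) atTop (𝓝 f) := by
  rw [ZeroAtInftyContinuousMap.tendsto_iff_tendstoUniformly, Metric.tendstoUniformly_iff]
  intro ε hε
  have hsmall : {x | ‖f x‖ < ε} ∈ cocompact ℝ :=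
    (zero_at_infty f).norm.eventually_lt_const (by simpa using hε)
  filter_upwards [eventually_forall_abs_le_of_mem_cocompact hsmall] with n hn x
  have hfactor : f x - f x * compactCutoff n x = f x * (1 - compactCutoff n x) := by ring
  change dist (f x) (f x * compactCutoff n x) < ε
  rw [dist_eq_norm, hfactor]
  by_cases hx : ‖f x‖ < ε
  · rw [norm_mul]
    exact (mul_le_of_le_one_right (norm_nonneg _) (norm_one_sub_compactCutoff_le n x)).trans_lt hx
  · rwa [compactCutoff_apply, cutoff_eq_one (hn x hx), Complex.ofReal_one, sub_self, mul_zero,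
      norm_zero]

theorem eventually_smul_compactCutoff_mul_eq (e : C(ℝ, ℂ)) (g : C_c(ℝ, ℂ)) :
    ∀ᶠ n in atTop, (e • compactCutoff n) * g = e • g := by
  have hsupp : {x | g x = 0} ∈ cocompact ℝ :=
    mem_of_superset g.hasCompactSupport.compl_mem_cocompact fun _ =>
      image_eq_zero_of_notMem_tsupport
  filter_upwards [eventually_forall_abs_le_of_mem_cocompact hsupp] with n hn
  ext x
  change e x * compactCutoff n x * g x = e x * g x
  by_cases hx : g x = 0
  · rw [hx, mul_zero, mul_zero]
  · rw [compactCutoff_apply, cutoff_eq_one (hn x hx), Complex.ofReal_one, mul_one]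

end Cutoff

section Exponential

variable {H : Type*} [NormedAddCommGroup H] [InnerProductSpace ℂ H] [CompleteSpace H]
  {A : H →ₗ.[ℂ] H}

theorem tendsto_applyFun_smul_compactCutoff (hA : IsSelfAdjoint A) (f : C₀(ℝ, ℂ)) (v : H) :
    Tendsto (fun n => A.applyFun (f • compactCutoff n : C_c(ℝ, ℂ)) v) atTop
      (𝓝 (A.applyFun f v)) := by
  have hlim := ((continuous_applyFunHom hA).tendsto f).comp (tendsto_smul_compactCutoff f)
  exact ((ContinuousLinearMap.apply ℂ H v).continuous.tendsto _).comp hlim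

theorem dense_setOf_applyFun (hA : IsSelfAdjoint A) :
    Dense {w : H | ∃ (g : C_c(ℝ, ℂ)) (u : H), A.applyFun g u = w} := by
  refine dense_iff_closure_eq.2 (Set.eq_univ_of_univ_subset ?_)
  rw [← (denseRange_resolventAtNegI hA).closure_range]
  refine closure_minimal ?_ isClosed_closure
  rintro _ ⟨u, rfl⟩
  rw [← applyFun_resolventFun hA]
  exact mem_closure_of_tendsto (tendsto_applyFun_smul_compactCutoff hA resolventFun u)
    (.of_forall fun n => ⟨_, u, rfl⟩)

theorem norm_applyFun_apply_le (hA : IsSelfAdjoint A) (f : C₀(ℝ, ℂ)) (hf : ∀ x, ‖f x‖ ≤ 1)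
    (v : H) : ‖A.applyFun f v‖ ≤ 1 * ‖v‖ := by
  refine (A.applyFun f).le_of_opNorm_le ?_ v
  refine (NonUnitalStarAlgHom.norm_apply_le (applyFunHom hA) f).trans ?_
  rw [← ZeroAtInftyContinuousMap.norm_toBCF_eq_norm, BoundedContinuousFunction.norm_le zero_le_one]
  exact hf

theorem eventually_applyFun_smul_compactCutoff (hA : IsSelfAdjoint A) (e : C(ℝ, ℂ))
    (g : C_c(ℝ, ℂ)) (u : H) : ∀ᶠ n in atTop,
      A.applyFun (e • compactCutoff n : C_c(ℝ, ℂ)) (A.applyFun g u) =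
        A.applyFun (e • g : C_c(ℝ, ℂ)) u := by
  filter_upwards [eventually_smul_compactCutoff_mul_eq e g] with n hn
  rw [← hn]
  exact (DFunLike.congr_fun (map_mul (applyFunHom hA)
    ((e • compactCutoff n : C_c(ℝ, ℂ)) : C₀(ℝ, ℂ)) (g : C₀(ℝ, ℂ))) u).symm

theorem exists_tendsto_applyFun_smul_compactCutoff (hA : IsSelfAdjoint A) (e : C(ℝ, ℂ))
    (he : ∀ x, ‖e x‖ ≤ 1) : ∃ T : H →L[ℂ] H, ∀ v, Tendsto
      (fun n => A.applyFun (e • compactCutoff n : C_c(ℝ, ℂ)) v) atTop (𝓝 (T v)) := by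
  refine exists_tendsto_apply_of_dense (fun n => norm_applyFun_apply_le hA
    ((e • compactCutoff n : C_c(ℝ, ℂ)) : C₀(ℝ, ℂ)) fun x => ?_) (dense_setOf_applyFun hA) ?_
  · exact (norm_mul _ _).trans_le
      (mul_le_one₀ (he x) (norm_nonneg _) (norm_compactCutoff_le n x))
  · rintro _ ⟨g, u, rfl⟩
    exact (tendsto_nhds_of_eventually_eq
      (eventually_applyFun_smul_compactCutoff hA e g u)).cauchySeq

theorem tendsto_applyFun_compactCutoff (hA : IsSelfAdjoint A) (v : H) :
    Tendsto (fun n => A.applyFun (compactCutoff n) v) atTop (𝓝 v) := by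
  obtain ⟨T, hT⟩ := exists_tendsto_applyFun_smul_compactCutoff hA 1 (by simp)
  have hone (f : C_c(ℝ, ℂ)) : (1 : C(ℝ, ℂ)) • f = f := by ext; simp
  simp only [hone] at hT
  suffices ⇑T = id by simpa only [this, id_eq] using hT v
  refine T.continuous.ext_on (dense_setOf_applyFun hA) continuous_id ?_
  rintro _ ⟨g, u, rfl⟩
  have hg := eventually_applyFun_smul_compactCutoff hA 1 g u
  simp only [hone] at hg
  exact tendsto_nhds_unique (hT _) (tendsto_nhds_of_eventually_eq hg)

/-- The function `x ↦ exp (-i t x)`. -/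
noncomputable def expNegIFun (t : ℝ) : C(ℝ, ℂ) where
  toFun x := Complex.exp (-(Complex.I * t * x))
  continuous_toFun := by fun_prop

theorem coe_expNegIFun_smul_compactCutoff (t : ℝ) (n : ℕ) :
    ⇑(expNegIFun t • compactCutoff n : C_c(ℝ, ℂ)) =
      fun x => (cutoff n x : ℂ) * Complex.exp (-(Complex.I * t * x)) :=
  funext fun _ => mul_comm _ _

theorem tendsto_expNegI (hA : IsSelfAdjoint A) (t : ℝ) (v : H) :
    Tendsto (fun n => A.applyFun (expNegIFun t • compactCutoff n : C_c(ℝ, ℂ)) v) atTop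
      (𝓝 (A.expNegI t v)) := by
  have hlim := exists_tendsto_applyFun_smul_compactCutoff hA (expNegIFun t) fun x => by
    simp [expNegIFun, Complex.norm_exp]
  simp only [coe_expNegIFun_smul_compactCutoff] at hlim ⊢
  rw [LinearPMap.expNegI, dif_pos hlim]
  exact hlim.choose_spec v

theorem expNegI_zero (hA : IsSelfAdjoint A) : A.expNegI 0 = 1 := by
  ext v
  have hzero (n : ℕ) : expNegIFun 0 • compactCutoff n = compactCutoff n := by
    ext; simp [expNegIFun]
  refine tendsto_nhds_unique (tendsto_expNegI hA 0 v) ?_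
  simpa only [hzero, one_apply_eq_self] using tendsto_applyFun_compactCutoff hA v

theorem Intertwines.expNegI_apply {K : Type*} [NormedAddCommGroup K] [InnerProductSpace ℂ K]
    [CompleteSpace K] {B : K →ₗ.[ℂ] K} {V : K →L[ℂ] H} (hV : Intertwines B A V)
    (hA : IsSelfAdjoint A) (hB : IsSelfAdjoint B) (t : ℝ) (v : K) :
    A.expNegI t (V v) = V (B.expNegI t v) := by
  refine tendsto_nhds_unique (tendsto_expNegI hA t (V v)) ?_
  refine ((V.continuous.tendsto _).comp (tendsto_expNegI hB t v)).congr fun n => ?_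
  exact (hV.applyFun_apply hA hB ((expNegIFun t • compactCutoff n : C_c(ℝ, ℂ)) : C₀(ℝ, ℂ)) v).symm

end Exponential

section Restriction

variable {H : Type*} [NormedAddCommGroup H] [InnerProductSpace ℂ H] {A : H →ₗ.[ℂ] H}
  {K : ClosedSubmodule ℂ H}

theorem mem_graph_restrictTo {x y : K.toSubmodule} :
    (x, y) ∈ (A.restrictTo K).graph ↔ ((x : H), (y : H)) ∈ A.graph := by
  simp only [mem_graph_iff]
  constructor
  · rintro ⟨⟨_, hmem⟩, rfl, rfl⟩
    exact ⟨⟨_, hmem.choose⟩, rfl, rfl⟩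
  · rintro ⟨⟨_, hmem⟩, rfl, hy⟩
    exact ⟨⟨x, hmem, hy ▸ y.2⟩, rfl, Subtype.ext hy⟩

theorem intertwines_subtypeL : Intertwines (A.restrictTo K) A K.toSubmodule.subtypeL :=
  fun _ _ => mem_graph_restrictTo.1

theorem coe_mem_map_subtypeL {M : ClosedSubmodule ℂ K.toSubmodule} {v : K.toSubmodule} :
    (v : H) ∈ M.map K.toSubmodule.subtypeL ↔ v ∈ M := by
  have hM := M.isClosed.closure_eq
  rw [Topology.IsInducing.subtypeVal.closure_eq_preimage_closure_image] at hM
  exact Set.ext_iff.1 hM v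

end Restriction

section Orbit

variable {H : Type*} [NormedAddCommGroup H] [InnerProductSpace ℂ H] [CompleteSpace H]
  {A : H →ₗ.[ℂ] H} {S : Set H} {K : ClosedSubmodule ℂ H}

theorem orbit_le_iff : A.orbit S ≤ K ↔ ∀ f : C_c(ℝ, ℂ), ∀ w ∈ S, A.applyFun f w ∈ K := by
  rw [LinearPMap.orbit, Submodule.closure_le, Submodule.span_le]
  constructor
  · exact fun h f w hw => h ⟨f, w, hw, rfl⟩
  · rintro h _ ⟨f, w, hw, rfl⟩
    exact h f w hw

theorem applyFun_mem_orbit (f : C_c(ℝ, ℂ)) {w : H} (hw : w ∈ S) : A.applyFun f w ∈ A.orbit S :=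
  orbit_le_iff.1 le_rfl f w hw

theorem subset_orbit (hA : IsSelfAdjoint A) : S ⊆ A.orbit S := fun v hv =>
  (A.orbit S).isClosed.mem_of_tendsto (tendsto_applyFun_compactCutoff hA v)
    (.of_forall fun n => applyFun_mem_orbit (compactCutoff n) hv)

theorem isInvariant_iff_applyFun_mem (hA : IsSelfAdjoint A) :
    A.IsInvariant K ↔ ∀ f : C_c(ℝ, ℂ), ∀ v ∈ K, A.applyFun f v ∈ K := by
  constructor
  · intro hK
    exact orbit_le_iff.1 hK.le
  · intro hK
    exact (orbit_le_iff.2 hK).antisymm (subset_orbit hA)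

theorem IsInvariant.applyFun_mem (hK : A.IsInvariant K) (hA : IsSelfAdjoint A) (f : C₀(ℝ, ℂ))
    {v : H} (hv : v ∈ K) : A.applyFun f v ∈ K :=
  K.isClosed.mem_of_tendsto (tendsto_applyFun_smul_compactCutoff hA f v)
    (.of_forall fun _ => (isInvariant_iff_applyFun_mem hA).1 hK _ v hv)

theorem isInvariant_orbit (hA : IsSelfAdjoint A) (S : Set H) : A.IsInvariant (A.orbit S) := by
  refine (isInvariant_iff_applyFun_mem hA).2 fun f => ?_
  suffices A.orbit S ≤ (A.orbit S).comap (A.applyFun f) from this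
  refine orbit_le_iff.2 fun g w hw => ?_
  have hmul : A.applyFun (f * g : C_c(ℝ, ℂ)) w = A.applyFun f (A.applyFun g w) :=
    DFunLike.congr_fun (map_mul (applyFunHom hA) (f : C₀(ℝ, ℂ)) (g : C₀(ℝ, ℂ))) w
  rw [ClosedSubmodule.mem_comap, ← hmul]
  exact applyFun_mem_orbit (f * g) hw

theorem orbit_le_iff_subset (hA : IsSelfAdjoint A) (hK : A.IsInvariant K) :
    A.orbit S ≤ K ↔ S ⊆ K :=
  ⟨fun h => (subset_orbit hA).trans h,
    fun h => orbit_le_iff.2 fun f w hw => (isInvariant_iff_applyFun_mem hA).1 hK f w (h hw)⟩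

theorem isInvariant_top (hA : IsSelfAdjoint A) : A.IsInvariant ⊤ :=
  (isInvariant_iff_applyFun_mem hA).2 fun _ _ _ => ClosedSubmodule.mem_top

theorem isInvariant_bot (hA : IsSelfAdjoint A) : A.IsInvariant ⊥ := by
  refine (isInvariant_iff_applyFun_mem hA).2 fun f v hv => ?_
  rw [ClosedSubmodule.mem_bot] at hv ⊢
  rw [hv, map_zero]

variable {L : Type*} [NormedAddCommGroup L] [InnerProductSpace ℂ L] [CompleteSpace L]
  {B : L →ₗ.[ℂ] L} {V : L →L[ℂ] H}

theorem Intertwines.orbit_image (hV : Intertwines B A V) (hA : IsSelfAdjoint A)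
    (hB : IsSelfAdjoint B) (S : Set L) : A.orbit (V '' S) = (B.orbit S).map V := by
  have hcomm (f : C_c(ℝ, ℂ)) (w : L) : A.applyFun f (V w) = V (B.applyFun f w) :=
    hV.applyFun_apply hA hB (f : C₀(ℝ, ℂ)) w
  apply le_antisymm
  · rw [orbit_le_iff]
    rintro f _ ⟨w, hw, rfl⟩
    rw [hcomm]
    have hle : B.orbit S ≤ ((B.orbit S).map V).comap V :=
      ClosedSubmodule.map_le_iff_le_comap.1 le_rfl
    exact hle (applyFun_mem_orbit f hw)
  · rw [ClosedSubmodule.map_le_iff_le_comap, orbit_le_iff]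
    intro f w hw
    rw [ClosedSubmodule.mem_comap, ← hcomm]
    exact applyFun_mem_orbit f ⟨w, hw, rfl⟩

end Orbit

section Projection

variable {E F : Type*} [NormedAddCommGroup E] [InnerProductSpace ℂ E] [CompleteSpace E]
  [NormedAddCommGroup F] [InnerProductSpace ℂ F] [CompleteSpace F]

theorem mapsTo_of_comp_starProjection_eq {T : E →L[ℂ] F} {K : ClosedSubmodule ℂ E}
    {L : ClosedSubmodule ℂ F}
    (h : T ∘L K.toSubmodule.starProjection = L.toSubmodule.starProjection ∘L T) :
    ∀ v ∈ K, T v ∈ L := fun v hv => by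
  have hv' := DFunLike.congr_fun h v
  rw [ContinuousLinearMap.comp_apply, ContinuousLinearMap.comp_apply,
    Submodule.starProjection_eq_self_iff.2 hv] at hv'
  exact Submodule.starProjection_eq_self_iff.1 hv'.symm

theorem adjoint_comp_starProjection_eq {T : E →L[ℂ] F} {K : ClosedSubmodule ℂ E}
    {L : ClosedSubmodule ℂ F}
    (h : T ∘L K.toSubmodule.starProjection = L.toSubmodule.starProjection ∘L T) :
    T.adjoint ∘L L.toSubmodule.starProjection = K.toSubmodule.starProjection ∘L T.adjoint := by
  have hadj := congrArg ContinuousLinearMap.adjoint h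
  rwa [ContinuousLinearMap.adjoint_comp, ContinuousLinearMap.adjoint_comp,
    (isSelfAdjoint_starProjection _).adjoint_eq, (isSelfAdjoint_starProjection _).adjoint_eq,
    eq_comm] at hadj

theorem comp_starProjection_eq_iff {T : E →L[ℂ] F} {K : ClosedSubmodule ℂ E}
    {L : ClosedSubmodule ℂ F} :
    T ∘L K.toSubmodule.starProjection = L.toSubmodule.starProjection ∘L T ↔
      (∀ v ∈ K, T v ∈ L) ∧ ∀ w ∈ L, T.adjoint w ∈ K := by
  constructor
  · exact fun h => ⟨mapsTo_of_comp_starProjection_eq h,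
      mapsTo_of_comp_starProjection_eq (adjoint_comp_starProjection_eq h)⟩
  · rintro ⟨hT, hTadj⟩
    refine ContinuousLinearMap.ext fun v => ?_
    refine (Submodule.eq_starProjection_of_mem_of_inner_eq_zero
      (hT _ (K.toSubmodule.starProjection_apply_mem v)) fun w hw => ?_).symm
    change inner ℂ (T v - T (K.toSubmodule.starProjection v)) w = 0
    rw [← map_sub, ← ContinuousLinearMap.adjoint_inner_right]
    exact K.toSubmodule.starProjection_inner_eq_zero v _ (hTadj w hw)

theorem forall_apply_mem_iff_adjoint_eq_zero {T : E →L[ℂ] F} {K : ClosedSubmodule ℂ F} :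
    (∀ v, T v ∈ K) ↔ ∀ w ∈ K.toSubmoduleᗮ, T.adjoint w = 0 := by
  constructor
  · refine fun hT w hw => ext_inner_left ℂ fun v => ?_
    rw [ContinuousLinearMap.adjoint_inner_right, inner_zero_right]
    exact Submodule.inner_right_of_mem_orthogonal (hT v) hw
  · intro hT v
    rw [← ClosedSubmodule.mem_toSubmodule_iff, ← K.toSubmodule.orthogonal_orthogonal]
    intro w hw
    rw [← ContinuousLinearMap.adjoint_inner_left, hT w hw, inner_zero_left]

theorem adjoint_starProjection_of_forall_apply_mem {T : E →L[ℂ] F} {K : ClosedSubmodule ℂ F}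
    (hT : ∀ v, T v ∈ K) (w : F) : T.adjoint (K.toSubmodule.starProjection w) = T.adjoint w := by
  have hzero := forall_apply_mem_iff_adjoint_eq_zero.1 hT _
    (K.toSubmodule.sub_starProjection_mem_orthogonal w)
  rw [map_sub, sub_eq_zero] at hzero
  exact hzero.symm

theorem forall_adjoint_apply_mem {T : E →L[ℂ] F} {K : ClosedSubmodule ℂ E}
    {L : ClosedSubmodule ℂ F} (hT : ∀ v, T v ∈ L) (hTadj : ∀ w ∈ L, T.adjoint w ∈ K) (w : F) :
    T.adjoint w ∈ K := by
  rw [← adjoint_starProjection_of_forall_apply_mem hT]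
  exact hTadj _ (L.toSubmodule.starProjection_apply_mem w)

end Projection

section Invariance

variable {H : Type*} [NormedAddCommGroup H] [InnerProductSpace ℂ H] [CompleteSpace H]
  {A : H →ₗ.[ℂ] H} {K : ClosedSubmodule ℂ H}

theorem isInvariant_iff_intertwines_starProjection (hA : IsSelfAdjoint A) :
    A.IsInvariant K ↔ Intertwines A A K.toSubmodule.starProjection := by
  constructor
  · intro hK
    rw [intertwines_iff_resolventAtNegI_comp hA hA, comp_starProjection_eq_iff,
      ← applyFun_resolventFun hA]
    refine ⟨fun v hv => IsInvariant.applyFun_mem hK hA _ hv, fun v hv => ?_⟩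
    have hstar := map_star (applyFunHom hA) resolventFun
    exact DFunLike.congr_fun hstar v ▸ IsInvariant.applyFun_mem hK hA (star resolventFun) hv
  · intro hP
    refine (isInvariant_iff_applyFun_mem hA).2 fun f => mapsTo_of_comp_starProjection_eq ?_
    ext v
    exact hP.applyFun_apply hA hA (f : C₀(ℝ, ℂ)) v

theorem intertwines_orthogonalProjectionOnto (hA : IsSelfAdjoint A) (hK : A.IsInvariant K) :
    Intertwines A (A.restrictTo K) K.toSubmodule.orthogonalProjectionOnto := fun x y hxy =>
  mem_graph_restrictTo.2 ((isInvariant_iff_intertwines_starProjection hA).1 hK x y hxy)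

theorem isInvariant_orthogonal (hA : IsSelfAdjoint A) (hK : A.IsInvariant K) :
    A.IsInvariant K.orthogonal := by
  rw [isInvariant_iff_intertwines_starProjection hA] at hK ⊢
  intro x y hxy
  have hsub := A.graph.sub_mem hxy (hK x y hxy)
  rw [Prod.mk_sub_mk, ← Submodule.starProjection_orthogonal_val,
    ← Submodule.starProjection_orthogonal_val] at hsub
  exact hsub

theorem isSelfAdjoint_restrictTo (hA : IsSelfAdjoint A) (hK : A.IsInvariant K) :
    IsSelfAdjoint (A.restrictTo K) := by
  have hproj := intertwines_orthogonalProjectionOnto hA hK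
  refine (isSelfAdjoint_iff_graph _).2 ⟨?_, fun x w => ⟨fun hxw y z hyz => ?_, fun h => ?_⟩⟩
  · have hsurj : Function.Surjective K.toSubmodule.orthogonalProjectionOnto :=
      fun v => ⟨v, K.toSubmodule.orthogonalProjectionOnto_mem_subspace_eq_self v⟩
    refine (hsurj.denseRange.dense_image (ContinuousLinearMap.continuous _) hA.dense_domain).mono ?_
    rintro _ ⟨v, hv, rfl⟩
    exact mem_domain_of_mem_graph (hproj _ _ (A.mem_graph ⟨v, hv⟩))
  · exact inner_eq_of_mem_graph hA (mem_graph_restrictTo.1 hxw) (mem_graph_restrictTo.1 hyz)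
  · refine mem_graph_restrictTo.2 (mem_graph_of_inner_eq hA fun y z hyz => ?_)
    rw [← Submodule.inner_orthogonalProjectionOnto_eq_of_mem_right,
      ← Submodule.inner_orthogonalProjectionOnto_eq_of_mem_right]
    exact h _ _ (hproj y z hyz)

theorem coe_expNegI_restrictTo (hA : IsSelfAdjoint A) (hK : A.IsInvariant K) (t : ℝ)
    (v : K.toSubmodule) : ((A.restrictTo K).expNegI t v : H) = A.expNegI t v :=
  (intertwines_subtypeL.expNegI_apply hA (isSelfAdjoint_restrictTo hA hK) t v).symm

theorem orbit_restrictTo_eq_top_iff (hA : IsSelfAdjoint A) (hK : A.IsInvariant K)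
    {S : Set K.toSubmodule} :
    (A.restrictTo K).orbit S = ⊤ ↔ K ≤ A.orbit (Subtype.val '' S) := by
  have hmap := intertwines_subtypeL.orbit_image hA (isSelfAdjoint_restrictTo hA hK) S
  rw [Submodule.coe_subtypeL, Submodule.coe_subtype] at hmap
  rw [hmap, ← top_le_iff]
  constructor
  · exact fun h v hv => coe_mem_map_subtypeL.2 (h (x := ⟨v, hv⟩) trivial)
  · exact fun h v _ => coe_mem_map_subtypeL.1 (h v.2)

end Invariance

end UnboundedOperator

namespace CoupledSystem

open UnboundedOperator
open LinearPMap (mem_graph_iff graph_fst_eq_zero_snd)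

section DirectSum

variable {H₁ H₂ : Type*} [NormedAddCommGroup H₁] [InnerProductSpace ℂ H₁]
  [NormedAddCommGroup H₂] [InnerProductSpace ℂ H₂]
  {K₁ L₁ : ClosedSubmodule ℂ H₁} {K₂ L₂ : ClosedSubmodule ℂ H₂}
  {K : ClosedSubmodule ℂ (WithLp 2 (H₁ × H₂))}

theorem mem_directSum {x : WithLp 2 (H₁ × H₂)} :
    x ∈ directSum K₁ K₂ ↔ x.fst ∈ K₁ ∧ x.snd ∈ K₂ := Iff.rfl

theorem directSum_le_iff : directSum K₁ K₂ ≤ directSum L₁ L₂ ↔ K₁ ≤ L₁ ∧ K₂ ≤ L₂ := by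
  constructor
  · intro h
    have hinl (v : H₁) (hv : v ∈ K₁) : WithLp.toLp 2 (v, (0 : H₂)) ∈ directSum K₁ K₂ :=
      ⟨hv, zero_mem K₂⟩
    have hinr (v : H₂) (hv : v ∈ K₂) : WithLp.toLp 2 ((0 : H₁), v) ∈ directSum K₁ K₂ :=
      ⟨zero_mem K₁, hv⟩
    exact ⟨fun v hv => (h (hinl v hv)).1, fun v hv => (h (hinr v hv)).2⟩
  · exact fun h x hx => ⟨h.1 hx.1, h.2 hx.2⟩

theorem exists_eq_directSum (h : ∀ x ∈ K, WithLp.toLp 2 (x.fst, (0 : H₂)) ∈ K) :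
    ∃ K₁ K₂, K = directSum K₁ K₂ := by
  have hsplit (x : WithLp 2 (H₁ × H₂)) :
      x = WithLp.toLp 2 (x.fst, 0) + WithLp.toLp 2 (0, x.snd) :=
    WithLp.ofLp_injective 2 (Prod.ext (add_zero _).symm (zero_add _).symm)
  let toLpL : H₁ × H₂ →L[ℂ] WithLp 2 (H₁ × H₂) :=
    (WithLp.prodContinuousLinearEquiv 2 ℂ H₁ H₂).symm
  refine ⟨K.comap (toLpL ∘L .inl ℂ H₁ H₂), K.comap (toLpL ∘L .inr ℂ H₁ H₂), ?_⟩
  ext x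
  constructor
  · refine fun hx => ⟨h x hx, ?_⟩
    have hsub := K.toSubmodule.sub_mem hx (h x hx)
    rwa [← eq_sub_of_add_eq' (hsplit x).symm] at hsub
  · rintro ⟨hfst, hsnd⟩
    rw [hsplit x]
    exact K.toSubmodule.add_mem hfst hsnd

theorem exists_eq_directSum_top_left (h : directSum ⊤ ⊥ ≤ K) : ∃ K₂, K = directSum ⊤ K₂ := by
  obtain ⟨K₁, K₂, rfl⟩ := exists_eq_directSum fun x _ =>
    h (mem_directSum.2 ⟨ClosedSubmodule.mem_top, ClosedSubmodule.mem_bot.2 rfl⟩)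
  exact ⟨K₂, by rw [top_le_iff.1 (directSum_le_iff.1 h).1]⟩

theorem exists_eq_directSum_top_right (h : directSum ⊥ ⊤ ≤ K) : ∃ K₁, K = directSum K₁ ⊤ := by
  have hfst (x : WithLp 2 (H₁ × H₂)) (hx : x ∈ K) : WithLp.toLp 2 (x.fst, (0 : H₂)) ∈ K := by
    have hsnd : x - WithLp.toLp 2 (x.fst, 0) ∈ K :=
      h (mem_directSum.2 ⟨sub_self x.fst, ClosedSubmodule.mem_top⟩)
    have hsub := K.toSubmodule.sub_mem hx hsnd
    rwa [sub_sub_self] at hsub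
  obtain ⟨K₁, K₂, rfl⟩ := exists_eq_directSum hfst
  exact ⟨K₁, by rw [top_le_iff.1 (directSum_le_iff.1 h).2]⟩

theorem starProjection_directSum [CompleteSpace H₁] [CompleteSpace H₂]
    (K₁ : ClosedSubmodule ℂ H₁) (K₂ : ClosedSubmodule ℂ H₂) (x : WithLp 2 (H₁ × H₂)) :
    (directSum K₁ K₂).toSubmodule.starProjection x =
      WithLp.toLp 2 (K₁.toSubmodule.starProjection x.fst, K₂.toSubmodule.starProjection x.snd) := by
  refine Submodule.eq_starProjection_of_mem_of_inner_eq_zero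
    ⟨K₁.toSubmodule.starProjection_apply_mem _, K₂.toSubmodule.starProjection_apply_mem _⟩
    fun w hw => ?_
  have hfst := K₁.toSubmodule.starProjection_inner_eq_zero x.fst w.fst hw.1
  have hsnd := K₂.toSubmodule.starProjection_inner_eq_zero x.snd w.snd hw.2
  rw [WithLp.prod_inner_apply]
  exact (congrArg₂ (· + ·) hfst hsnd).trans (add_zero 0)

end DirectSum

section System

variable {H₁ H₂ : Type*} [NormedAddCommGroup H₁] [InnerProductSpace ℂ H₁] [CompleteSpace H₁]
  [NormedAddCommGroup H₂] [InnerProductSpace ℂ H₂] [CompleteSpace H₂]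
  {S : CoupledSystem H₁ H₂} {K₁ : ClosedSubmodule ℂ H₁} {K₂ : ClosedSubmodule ℂ H₂}

theorem mem_graph_Ω_iff {x y : WithLp 2 (H₁ × H₂)} : (x, y) ∈ S.Ω.graph ↔
    (x.fst, y.fst - S.Γ x.snd) ∈ S.Ω₁.graph ∧ (x.snd, y.snd - S.Γ.adjoint x.fst) ∈ S.Ω₂.graph := by
  simp only [mem_graph_iff]
  constructor
  · rintro ⟨⟨u, hu⟩, rfl, rfl⟩
    exact ⟨⟨⟨_, hu.1⟩, rfl, (add_sub_cancel_right _ _).symm⟩,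
      ⟨⟨_, hu.2⟩, rfl, (add_sub_cancel_left _ _).symm⟩⟩
  · rintro ⟨⟨⟨_, hfst⟩, rfl, h₁⟩, ⟨_, hsnd⟩, rfl, h₂⟩
    exact ⟨⟨x, hfst, hsnd⟩, rfl, WithLp.ofLp_injective 2
      (Prod.ext (eq_sub_iff_add_eq.1 h₁) (eq_sub_iff_add_eq'.1 h₂))⟩

theorem inl_mem_graph_Ω {y z : H₁} (h : (y, z) ∈ S.Ω₁.graph) :
    (WithLp.toLp 2 (y, (0 : H₂)), WithLp.toLp 2 (z, S.Γ.adjoint y)) ∈ S.Ω.graph := by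
  rw [mem_graph_Ω_iff]
  simpa using h

theorem inr_mem_graph_Ω {y z : H₂} (h : (y, z) ∈ S.Ω₂.graph) :
    (WithLp.toLp 2 ((0 : H₁), y), WithLp.toLp 2 (S.Γ y, z)) ∈ S.Ω.graph := by
  rw [mem_graph_Ω_iff]
  simpa using h

theorem dense_domain_Ω (hS : S.IsConservative) : Dense (S.Ω.domain : Set (WithLp 2 (H₁ × H₂))) :=
  (hS.1.dense_domain.prod hS.2.dense_domain).preimage (WithLp.homeomorphProd 2 H₁ H₂).isOpenMap

theorem inner_eq_of_mem_graph_Ω (hS : S.IsConservative) {x w y z : WithLp 2 (H₁ × H₂)}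
    (hxw : (x, w) ∈ S.Ω.graph) (hyz : (y, z) ∈ S.Ω.graph) : inner ℂ z x = inner ℂ y w := by
  rw [mem_graph_Ω_iff] at hxw hyz
  have hfst := inner_eq_of_mem_graph hS.1 hxw.1 hyz.1
  have hsnd := inner_eq_of_mem_graph hS.2 hxw.2 hyz.2
  rw [inner_sub_left, inner_sub_right] at hfst
  rw [inner_sub_left, inner_sub_right, ContinuousLinearMap.adjoint_inner_left,
    ContinuousLinearMap.adjoint_inner_right] at hsnd
  rw [WithLp.prod_inner_apply, WithLp.prod_inner_apply]
  change inner ℂ z.fst x.fst + inner ℂ z.snd x.snd = inner ℂ y.fst w.fst + inner ℂ y.snd w.snd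
  linear_combination hfst + hsnd

theorem isSelfAdjoint_Ω (hS : S.IsConservative) : IsSelfAdjoint S.Ω := by
  refine (isSelfAdjoint_iff_graph _).2 ⟨dense_domain_Ω hS, fun x w =>
    ⟨fun hxw y z => inner_eq_of_mem_graph_Ω hS hxw, fun h => mem_graph_Ω_iff.2 ⟨?_, ?_⟩⟩⟩
  · refine mem_graph_of_inner_eq hS.1 fun y z hyz => ?_
    have hinl := h _ _ (inl_mem_graph_Ω hyz)
    rw [WithLp.prod_inner_apply, WithLp.prod_inner_apply] at hinl
    change inner ℂ z x.fst + inner ℂ (S.Γ.adjoint y) x.snd =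
      inner ℂ y w.fst + inner ℂ (0 : H₂) w.snd at hinl
    rw [inner_zero_left, ContinuousLinearMap.adjoint_inner_left] at hinl
    rw [inner_sub_right]
    linear_combination hinl
  · refine mem_graph_of_inner_eq hS.2 fun y z hyz => ?_
    have hinr := h _ _ (inr_mem_graph_Ω hyz)
    rw [WithLp.prod_inner_apply, WithLp.prod_inner_apply] at hinr
    change inner ℂ (S.Γ y) x.fst + inner ℂ z x.snd =
      inner ℂ (0 : H₁) w.fst + inner ℂ y w.snd at hinr
    rw [inner_zero_left] at hinr
    rw [inner_sub_right, ContinuousLinearMap.adjoint_inner_right]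
    linear_combination hinr

theorem intertwines_starProjection_directSum_iff (hS : S.IsConservative) :
    Intertwines S.Ω S.Ω (directSum K₁ K₂).toSubmodule.starProjection ↔
      Intertwines S.Ω₁ S.Ω₁ K₁.toSubmodule.starProjection ∧
      Intertwines S.Ω₂ S.Ω₂ K₂.toSubmodule.starProjection ∧
      S.Γ ∘L K₂.toSubmodule.starProjection = K₁.toSubmodule.starProjection ∘L S.Γ := by
  constructor
  · intro h
    have hinl {y z : H₁} (hyz : (y, z) ∈ S.Ω₁.graph) := h _ _ (inl_mem_graph_Ω hyz)
    have hinr {y z : H₂} (hyz : (y, z) ∈ S.Ω₂.graph) := h _ _ (inr_mem_graph_Ω hyz)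
    simp only [starProjection_directSum, mem_graph_Ω_iff, WithLp.toLp_fst, WithLp.toLp_snd,
      map_zero, sub_zero] at hinl hinr
    have hΓ : Set.EqOn (S.Γ ∘L K₂.toSubmodule.starProjection)
        (K₁.toSubmodule.starProjection ∘L S.Γ) S.Ω₂.domain := fun y hy =>
      (sub_eq_zero.1 (graph_fst_eq_zero_snd _ (hinr (S.Ω₂.mem_graph ⟨y, hy⟩)).1 rfl)).symm
    exact ⟨fun y z hyz => (hinl hyz).1, fun y z hyz => (hinr hyz).2, DFunLike.coe_injective
      (Continuous.ext_on hS.2.dense_domain (ContinuousLinearMap.continuous _)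
        (ContinuousLinearMap.continuous _) hΓ)⟩
  · rintro ⟨h₁, h₂, hΓ⟩ x y hxy
    have hΓx := DFunLike.congr_fun hΓ x.snd
    have hΓadjx := DFunLike.congr_fun (adjoint_comp_starProjection_eq hΓ) x.fst
    rw [ContinuousLinearMap.comp_apply, ContinuousLinearMap.comp_apply] at hΓx hΓadjx
    rw [mem_graph_Ω_iff] at hxy
    have hfst := h₁ _ _ hxy.1
    have hsnd := h₂ _ _ hxy.2
    rw [map_sub, ← hΓx] at hfst
    rw [map_sub, ← hΓadjx] at hsnd
    rw [starProjection_directSum, starProjection_directSum, mem_graph_Ω_iff]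
    exact ⟨hfst, hsnd⟩

theorem isInvariant_directSum_iff (hS : S.IsConservative) :
    S.Ω.IsInvariant (directSum K₁ K₂) ↔ S.Ω₁.IsInvariant K₁ ∧ S.Ω₂.IsInvariant K₂ ∧
      (∀ v ∈ K₂, S.Γ v ∈ K₁) ∧ ∀ v ∈ K₁, S.Γ.adjoint v ∈ K₂ := by
  rw [isInvariant_iff_intertwines_starProjection (isSelfAdjoint_Ω hS),
    isInvariant_iff_intertwines_starProjection hS.1,
    isInvariant_iff_intertwines_starProjection hS.2, ← comp_starProjection_eq_iff,
    intertwines_starProjection_directSum_iff hS]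

theorem IsConservative.swap (hS : S.IsConservative) : S.swap.IsConservative := ⟨hS.2, hS.1⟩

theorem adjoint_swap_Γ : S.swap.Γ.adjoint = S.Γ :=
  ContinuousLinearMap.adjoint_adjoint _

theorem swap_a₁ (t : ℝ) : S.swap.a₁ t = S.a₂ t := by
  rw [a₁, adjoint_swap_Γ]
  rfl

theorem swap_openSystem₁ : S.swap.openSystem₁ = S.openSystem₂ :=
  congrArg (OpenSystem.mk S.Ω₂) (funext swap_a₁)

theorem swap_subsystem : (S.subsystem K₁ K₂).swap = S.swap.subsystem K₂ K₁ := by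
  simp only [subsystem, swap, ContinuousLinearMap.adjoint_comp,
    ContinuousLinearMap.adjoint_adjoint]
  rfl

theorem isInvariant_swap_directSum_iff (hS : S.IsConservative) :
    S.swap.Ω.IsInvariant (directSum K₂ K₁) ↔ S.Ω.IsInvariant (directSum K₁ K₂) := by
  rw [isInvariant_directSum_iff hS.swap, isInvariant_directSum_iff hS, adjoint_swap_Γ]
  exact ⟨fun ⟨h₂, h₁, hΓadj, hΓ⟩ => ⟨h₁, h₂, hΓ, hΓadj⟩,
    fun ⟨h₁, h₂, hΓ, hΓadj⟩ => ⟨h₂, h₁, hΓadj, hΓ⟩⟩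

theorem determines₁_swap_iff : S.swap.Determines₁ K₂ K₁ ↔ S.Determines₂ K₁ K₂ := by
  simp only [Determines₁, Determines₂, ← swap_subsystem, swap_a₁]

end System

section CoupledPart

variable {H₁ H₂ : Type*} [NormedAddCommGroup H₁] [InnerProductSpace ℂ H₁] [CompleteSpace H₁]
  [NormedAddCommGroup H₂] [InnerProductSpace ℂ H₂]
  {S : CoupledSystem H₁ H₂} {K₁ : ClosedSubmodule ℂ H₁} {K₂ : ClosedSubmodule ℂ H₂}

theorem coe_subsystem_Γ (v : K₂.toSubmodule) :
    ((S.subsystem K₁ K₂).Γ v : H₁) = K₁.toSubmodule.starProjection (S.Γ v) := by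
  simp only [subsystem, Submodule.adjoint_subtypeL]
  rfl

variable [CompleteSpace H₂]

theorem coe_subsystem_adjoint_Γ (v : K₁.toSubmodule) :
    ((S.subsystem K₁ K₂).Γ.adjoint v : H₂) = K₂.toSubmodule.starProjection (S.Γ.adjoint v) := by
  change ((S.subsystem K₁ K₂).swap.Γ v : H₂) = _
  rw [swap_subsystem, coe_subsystem_Γ]
  rfl

theorem isConservative_subsystem (hS : S.IsConservative)
    (h : S.Ω.IsInvariant (directSum K₁ K₂)) : (S.subsystem K₁ K₂).IsConservative := by
  obtain ⟨h₁, h₂, -⟩ := (isInvariant_directSum_iff hS).1 h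
  exact ⟨isSelfAdjoint_restrictTo hS.1 h₁, isSelfAdjoint_restrictTo hS.2 h₂⟩

theorem a₁_eq_subsystem_a₁ (hS : S.IsConservative) (h : S.Ω.IsInvariant (directSum K₁ K₂))
    (t : ℝ) (v : K₁.toSubmodule) :
    S.a₁ t v = ((S.subsystem K₁ K₂).a₁ t v : K₁.toSubmodule) := by
  obtain ⟨-, h₂, hΓ, hΓadj⟩ := (isInvariant_directSum_iff hS).1 h
  have hcoeΓ (u : K₂.toSubmodule) : ((S.subsystem K₁ K₂).Γ u : H₁) = S.Γ u := by
    rw [coe_subsystem_Γ, Submodule.starProjection_eq_self_iff.2 (hΓ u u.2)]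
  have hcoeΓadj : ((S.subsystem K₁ K₂).Γ.adjoint v : H₂) = S.Γ.adjoint v := by
    rw [coe_subsystem_adjoint_Γ, Submodule.starProjection_eq_self_iff.2 (hΓadj v v.2)]
  simp only [a₁, ContinuousLinearMap.comp_apply]
  rw [hcoeΓ, ← hcoeΓadj]
  exact congrArg S.Γ (coe_expNegI_restrictTo hS.2 h₂ t _).symm

theorem a₂_eq_subsystem_a₂ (hS : S.IsConservative) (h : S.Ω.IsInvariant (directSum K₁ K₂))
    (t : ℝ) (v : K₂.toSubmodule) :
    S.a₂ t v = ((S.subsystem K₁ K₂).a₂ t v : K₂.toSubmodule) := by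
  rw [← swap_a₁, ← swap_a₁, swap_subsystem]
  exact a₁_eq_subsystem_a₁ hS.swap ((isInvariant_swap_directSum_iff hS).2 h) t v

theorem a₁_eq_zero (hΓ : ∀ w, S.Γ w ∈ K₁) {v : H₁} (hv : v ∈ K₁.toSubmoduleᗮ) (t : ℝ) :
    S.a₁ t v = 0 := by
  simp only [a₁, ContinuousLinearMap.comp_apply]
  rw [forall_apply_mem_iff_adjoint_eq_zero.1 hΓ v hv, map_zero, map_zero]

theorem a₂_eq_zero (hΓ : ∀ w, S.Γ.adjoint w ∈ K₂) {v : H₂} (hv : v ∈ K₂.toSubmoduleᗮ) (t : ℝ) :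
    S.a₂ t v = 0 :=
  (DFunLike.congr_fun (swap_a₁ t) v).symm.trans (a₁_eq_zero (S := S.swap) hΓ hv t)

/-- The part `H₁c` of `H₁` that is coupled to `H₂`: the `Ω₁`-orbit of `Ran Γ`. -/
noncomputable def coupledPart₁ (S : CoupledSystem H₁ H₂) : ClosedSubmodule ℂ H₁ :=
  S.Ω₁.orbit (Set.range S.Γ)

/-- The part `H₂c` of `H₂` that is coupled to `H₁`: the `Ω₂`-orbit of `Ran Γ†`. -/
noncomputable def coupledPart₂ (S : CoupledSystem H₁ H₂) : ClosedSubmodule ℂ H₂ :=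
  S.Ω₂.orbit (Set.range S.Γ.adjoint)

theorem swap_coupledPart₂ : S.swap.coupledPart₂ = S.coupledPart₁ := by
  rw [coupledPart₂, adjoint_swap_Γ]
  rfl

theorem isInvariant_coupledPart₁ (hS : S.IsConservative) : S.Ω₁.IsInvariant S.coupledPart₁ :=
  isInvariant_orbit hS.1 _

theorem isInvariant_coupledPart₂ (hS : S.IsConservative) : S.Ω₂.IsInvariant S.coupledPart₂ :=
  isInvariant_orbit hS.2 _

theorem Γ_mem_coupledPart₁ (hS : S.IsConservative) (w : H₂) : S.Γ w ∈ S.coupledPart₁ :=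
  subset_orbit hS.1 (Set.mem_range_self w)

theorem adjoint_Γ_mem_coupledPart₂ (hS : S.IsConservative) (w : H₁) :
    S.Γ.adjoint w ∈ S.coupledPart₂ :=
  subset_orbit hS.2 (Set.mem_range_self w)

theorem coupledPart₁_le_iff (hS : S.IsConservative) (h : S.Ω₁.IsInvariant K₁) :
    S.coupledPart₁ ≤ K₁ ↔ ∀ w, S.Γ w ∈ K₁ :=
  (orbit_le_iff_subset hS.1 h).trans Set.range_subset_iff

theorem coupledPart₂_le_iff (hS : S.IsConservative) (h : S.Ω₂.IsInvariant K₂) :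
    S.coupledPart₂ ≤ K₂ ↔ ∀ w, S.Γ.adjoint w ∈ K₂ :=
  (orbit_le_iff_subset hS.2 h).trans Set.range_subset_iff

theorem isInvariant_directSum_coupledPart (hS : S.IsConservative) :
    S.Ω.IsInvariant (directSum S.coupledPart₁ S.coupledPart₂) :=
  (isInvariant_directSum_iff hS).2 ⟨isInvariant_coupledPart₁ hS, isInvariant_coupledPart₂ hS,
    fun w _ => Γ_mem_coupledPart₁ hS w, fun w _ => adjoint_Γ_mem_coupledPart₂ hS w⟩

theorem isInvariant_directSum_top_coupledPart₂ (hS : S.IsConservative) :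
    S.Ω.IsInvariant (directSum ⊤ S.coupledPart₂) :=
  (isInvariant_directSum_iff hS).2 ⟨isInvariant_top hS.1, isInvariant_coupledPart₂ hS,
    fun _ _ => ClosedSubmodule.mem_top, fun w _ => adjoint_Γ_mem_coupledPart₂ hS w⟩

theorem isInvariant_directSum_coupledPart₁_top (hS : S.IsConservative) :
    S.Ω.IsInvariant (directSum S.coupledPart₁ ⊤) := by
  rw [← isInvariant_swap_directSum_iff hS, ← swap_coupledPart₂]
  exact isInvariant_directSum_top_coupledPart₂ hS.swap

theorem directSum_coupledPart_le (hS : S.IsConservative)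
    (h : S.Ω.IsInvariant (directSum K₁ K₂)) (hΓ : ∀ w, S.Γ w ∈ K₁) :
    directSum S.coupledPart₁ S.coupledPart₂ ≤ directSum K₁ K₂ := by
  obtain ⟨h₁, h₂, -, hΓadj⟩ := (isInvariant_directSum_iff hS).1 h
  exact directSum_le_iff.2 ⟨(coupledPart₁_le_iff hS h₁).2 hΓ,
    (coupledPart₂_le_iff hS h₂).2 (forall_adjoint_apply_mem hΓ hΓadj)⟩

theorem isLeast_directSum_coupledPart (hS : S.IsConservative) :
    IsLeast {K | S.IsSplitInvariantContainingRange K}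
      (directSum S.coupledPart₁ S.coupledPart₂) := by
  refine ⟨⟨isInvariant_directSum_coupledPart hS, ⟨_, _, rfl⟩, fun w =>
    ⟨Γ_mem_coupledPart₁ hS w, zero_mem S.coupledPart₂⟩⟩, ?_⟩
  rintro _ ⟨h, ⟨K₁, K₂, rfl⟩, hΓ⟩
  exact directSum_coupledPart_le hS h fun w => (hΓ w).1

theorem existsUnique_minimal_isSplitInvariantContainingRange (hS : S.IsConservative) :
    ∃! K, Minimal S.IsSplitInvariantContainingRange K :=
  ⟨_, (isLeast_directSum_coupledPart hS).minimal,
    fun _ hK => (isLeast_directSum_coupledPart hS).minimal_iff.1 hK⟩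

theorem isReconstructible_iff (hS : S.IsConservative) :
    S.IsReconstructible ↔ S.coupledPart₁ = ⊤ ∧ S.coupledPart₂ = ⊤ := by
  rw [← swap_coupledPart₂]
  constructor
  · rintro ⟨⟨-, -, -, h₂⟩, -, -, -, h₁⟩
    exact ⟨h₁, h₂⟩
  · rintro ⟨h₁, h₂⟩
    exact ⟨⟨hS, rfl, fun _ _ => rfl, h₂⟩, hS.swap, rfl, fun t _ => swap_a₁ t, h₁⟩

theorem image_range_subsystem_adjoint_Γ (hΓ : ∀ w, S.Γ w ∈ K₁)
    (hΓadj : ∀ w, S.Γ.adjoint w ∈ K₂) :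
    Subtype.val '' Set.range (S.subsystem K₁ K₂).Γ.adjoint = Set.range S.Γ.adjoint := by
  have hcoe (v : K₁.toSubmodule) : ((S.subsystem K₁ K₂).Γ.adjoint v : H₂) = S.Γ.adjoint v := by
    rw [coe_subsystem_adjoint_Γ, Submodule.starProjection_eq_self_iff.2 (hΓadj v)]
  apply Set.Subset.antisymm
  · rintro _ ⟨_, ⟨v, rfl⟩, rfl⟩
    exact ⟨v, (hcoe v).symm⟩
  · rintro _ ⟨w, rfl⟩
    exact ⟨_, ⟨K₁.toSubmodule.orthogonalProjectionOnto w, rfl⟩,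
      (hcoe _).trans (adjoint_starProjection_of_forall_apply_mem hΓ w)⟩

theorem coupledPart₂_subsystem_eq_top_iff (hS : S.IsConservative)
    (h : S.Ω.IsInvariant (directSum K₁ K₂)) (hΓ : ∀ w, S.Γ w ∈ K₁) :
    (S.subsystem K₁ K₂).coupledPart₂ = ⊤ ↔ K₂ ≤ S.coupledPart₂ := by
  obtain ⟨-, h₂, -, hΓadj⟩ := (isInvariant_directSum_iff hS).1 h
  refine (orbit_restrictTo_eq_top_iff hS.2 h₂).trans ?_
  rw [image_range_subsystem_adjoint_Γ hΓ (forall_adjoint_apply_mem hΓ hΓadj)]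
  rfl

theorem isReconstructible_subsystem_coupledPart (hS : S.IsConservative) :
    (S.subsystem S.coupledPart₁ S.coupledPart₂).IsReconstructible := by
  have h := isInvariant_directSum_coupledPart hS
  refine (isReconstructible_iff (isConservative_subsystem hS h)).2 ⟨?_, ?_⟩
  · rw [← swap_coupledPart₂ (S := S.subsystem _ _), swap_subsystem,
      coupledPart₂_subsystem_eq_top_iff hS.swap ((isInvariant_swap_directSum_iff hS).2 h)
        (adjoint_Γ_mem_coupledPart₂ hS), swap_coupledPart₂]
  · exact (coupledPart₂_subsystem_eq_top_iff hS h (Γ_mem_coupledPart₁ hS)).2 le_rfl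

theorem coe_restrictSnd_adjoint_Γ (v : H₁) :
    ((S.restrictSnd K₂).Γ.adjoint v : H₂) = K₂.toSubmodule.starProjection (S.Γ.adjoint v) := by
  simp only [restrictSnd, ContinuousLinearMap.adjoint_comp, Submodule.adjoint_subtypeL]
  rfl

theorem isMinimalConservativeExtension_restrictSnd_iff (hS : S.IsConservative)
    (h : S.Ω.IsInvariant (directSum ⊤ K₂)) :
    IsMinimalConservativeExtension S.openSystem₁ (S.restrictSnd K₂) ↔ K₂ = S.coupledPart₂ := by
  obtain ⟨-, h₂, -, hΓadj⟩ := (isInvariant_directSum_iff hS).1 h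
  replace hΓadj (v : H₁) : S.Γ.adjoint v ∈ K₂ := hΓadj v ClosedSubmodule.mem_top
  have hcoe (v : H₁) : ((S.restrictSnd K₂).Γ.adjoint v : H₂) = S.Γ.adjoint v := by
    rw [coe_restrictSnd_adjoint_Γ, Submodule.starProjection_eq_self_iff.2 (hΓadj v)]
  have ha₁ (t : ℝ) : (S.restrictSnd K₂).a₁ t = S.a₁ t := by
    ext v
    simp only [a₁, ContinuousLinearMap.comp_apply]
    rw [← hcoe]
    exact congrArg S.Γ (coe_expNegI_restrictTo hS.2 h₂ t _)
  have htop : (S.restrictSnd K₂).coupledPart₂ = ⊤ ↔ K₂ ≤ S.coupledPart₂ := by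
    refine (orbit_restrictTo_eq_top_iff hS.2 h₂).trans ?_
    rw [← Set.range_comp, show Subtype.val ∘ _ = _ from funext hcoe]
    rfl
  calc IsMinimalConservativeExtension S.openSystem₁ (S.restrictSnd K₂)
    _ ↔ (S.restrictSnd K₂).coupledPart₂ = ⊤ :=
      ⟨fun hmin => hmin.2.2.2,
        fun h => ⟨⟨hS.1, isSelfAdjoint_restrictTo hS.2 h₂⟩, rfl, fun t _ => ha₁ t, h⟩⟩
    _ ↔ K₂ ≤ S.coupledPart₂ := htop
    _ ↔ K₂ = S.coupledPart₂ := ((coupledPart₂_le_iff hS h₂).2 hΓadj).ge_iff_eq'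

theorem isMinimalExtensionWithin₁_iff (hS : S.IsConservative)
    (K : ClosedSubmodule ℂ (WithLp 2 (H₁ × H₂))) :
    S.IsMinimalExtensionWithin₁ K ↔ K = directSum ⊤ S.coupledPart₂ := by
  constructor
  · rintro ⟨h, K₂, rfl, hmin⟩
    rw [(isMinimalConservativeExtension_restrictSnd_iff hS h).1 hmin]
  · rintro rfl
    have h := isInvariant_directSum_top_coupledPart₂ hS
    exact ⟨h, _, rfl, (isMinimalConservativeExtension_restrictSnd_iff hS h).2 rfl⟩

theorem isMinimalExtensionWithin₂_iff (hS : S.IsConservative)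
    (K : ClosedSubmodule ℂ (WithLp 2 (H₁ × H₂))) :
    S.IsMinimalExtensionWithin₂ K ↔ K = directSum S.coupledPart₁ ⊤ := by
  have hiff {K₁ : ClosedSubmodule ℂ H₁} (h : S.Ω.IsInvariant (directSum K₁ ⊤)) :
      IsMinimalConservativeExtension S.openSystem₂ (S.swap.restrictSnd K₁) ↔
        K₁ = S.coupledPart₁ := by
    rw [← swap_openSystem₁, isMinimalConservativeExtension_restrictSnd_iff hS.swap
      ((isInvariant_swap_directSum_iff hS).2 h), swap_coupledPart₂]
  constructor
  · rintro ⟨h, K₁, rfl, hmin⟩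
    rw [(hiff h).1 hmin]
  · rintro rfl
    have h := isInvariant_directSum_coupledPart₁_top hS
    exact ⟨h, _, rfl, (hiff h).2 rfl⟩

theorem orbit_directSum_top_bot (hS : S.IsConservative) :
    S.Ω.orbit (directSum (⊤ : ClosedSubmodule ℂ H₁) (⊥ : ClosedSubmodule ℂ H₂) :
      Set (WithLp 2 (H₁ × H₂))) = directSum ⊤ S.coupledPart₂ := by
  have hΩ := isSelfAdjoint_Ω hS
  apply le_antisymm
  · exact (orbit_le_iff_subset hΩ (isInvariant_directSum_top_coupledPart₂ hS)).2
      (directSum_le_iff.2 ⟨le_rfl, bot_le⟩)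
  · obtain ⟨K₂, hK₂⟩ := exists_eq_directSum_top_left (subset_orbit hΩ)
    have hinv := isInvariant_orbit hΩ
      (directSum (⊤ : ClosedSubmodule ℂ H₁) (⊥ : ClosedSubmodule ℂ H₂) : Set (WithLp 2 (H₁ × H₂)))
    rw [hK₂] at hinv ⊢
    obtain ⟨-, h₂, -, hΓadj⟩ := (isInvariant_directSum_iff hS).1 hinv
    exact directSum_le_iff.2 ⟨le_rfl,
      (coupledPart₂_le_iff hS h₂).2 fun w => hΓadj w ClosedSubmodule.mem_top⟩

theorem orbit_directSum_bot_top (hS : S.IsConservative) :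
    S.Ω.orbit (directSum (⊥ : ClosedSubmodule ℂ H₁) (⊤ : ClosedSubmodule ℂ H₂) :
      Set (WithLp 2 (H₁ × H₂))) = directSum S.coupledPart₁ ⊤ := by
  have hΩ := isSelfAdjoint_Ω hS
  apply le_antisymm
  · exact (orbit_le_iff_subset hΩ (isInvariant_directSum_coupledPart₁_top hS)).2
      (directSum_le_iff.2 ⟨bot_le, le_rfl⟩)
  · obtain ⟨K₁, hK₁⟩ := exists_eq_directSum_top_right (subset_orbit hΩ)
    have hinv := isInvariant_orbit hΩ
      (directSum (⊥ : ClosedSubmodule ℂ H₁) (⊤ : ClosedSubmodule ℂ H₂) : Set (WithLp 2 (H₁ × H₂)))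
    rw [hK₁] at hinv ⊢
    obtain ⟨h₁, -, hΓ, -⟩ := (isInvariant_directSum_iff hS).1 hinv
    exact directSum_le_iff.2 ⟨(coupledPart₁_le_iff hS h₁).2 fun w => hΓ w ClosedSubmodule.mem_top,
      le_rfl⟩

theorem adjoint_Γ_eq_zero_of_a₁_zero_eq_zero (hS : S.IsConservative) {v : H₁}
    (hv : S.a₁ 0 v = 0) : S.Γ.adjoint v = 0 := by
  have ha₁ : S.a₁ 0 = S.Γ ∘L S.Γ.adjoint := by
    rw [a₁, expNegI_zero hS.2]
    rfl
  rw [ha₁, ContinuousLinearMap.comp_apply] at hv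
  rw [← inner_self_eq_zero (𝕜 := ℂ), ContinuousLinearMap.adjoint_inner_left, hv, inner_zero_right]

theorem Determines₁.Γ_mem (h : S.Determines₁ K₁ K₂) (hS : S.IsConservative) :
    ∀ w, S.Γ w ∈ K₁ :=
  forall_apply_mem_iff_adjoint_eq_zero.2 fun v hv =>
    adjoint_Γ_eq_zero_of_a₁_zero_eq_zero hS ((h 0 le_rfl).2 v hv)

theorem directSum_coupledPart_le_of_determines₁ (hS : S.IsConservative)
    (h : S.Ω.IsInvariant (directSum K₁ K₂)) (hdet : S.Determines₁ K₁ K₂) :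
    directSum S.coupledPart₁ S.coupledPart₂ ≤ directSum K₁ K₂ :=
  directSum_coupledPart_le hS h (hdet.Γ_mem hS)

theorem directSum_coupledPart_le_of_determines₂ (hS : S.IsConservative)
    (h : S.Ω.IsInvariant (directSum K₁ K₂)) (hdet : S.Determines₂ K₁ K₂) :
    directSum S.coupledPart₁ S.coupledPart₂ ≤ directSum K₁ K₂ := by
  have hle := directSum_coupledPart_le_of_determines₁ hS.swap
    ((isInvariant_swap_directSum_iff hS).2 h) (determines₁_swap_iff.2 hdet)
  rw [swap_coupledPart₂] at hle
  exact directSum_le_iff.2 (directSum_le_iff.1 hle).symm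

theorem isInvariant_directSum_bot_iff (hS : S.IsConservative) :
    S.Ω.IsInvariant (directSum K₁ ⊥) ↔
      S.Ω₁.IsInvariant K₁ ∧ S.coupledPart₁ ≤ K₁.orthogonal := by
  rw [isInvariant_directSum_iff hS]
  refine and_congr_right fun h₁ => ?_
  rw [coupledPart₁_le_iff hS (isInvariant_orthogonal hS.1 h₁), forall_apply_mem_iff_adjoint_eq_zero,
    ClosedSubmodule.toSubmodule_orthogonal_eq, Submodule.orthogonal_orthogonal]
  simp only [ClosedSubmodule.mem_bot]
  constructor
  · exact fun ⟨_, _, hΓadj⟩ => hΓadj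
  · refine fun hΓadj => ⟨isInvariant_bot hS.2, ?_, hΓadj⟩
    rintro _ rfl
    rw [map_zero]
    exact zero_mem K₁

theorem coupledPart₁_eq_top_iff (hS : S.IsConservative) : S.coupledPart₁ = ⊤ ↔
    ∀ K₁ : ClosedSubmodule ℂ H₁, S.Ω.IsInvariant (directSum K₁ ⊥) → K₁ = ⊥ := by
  simp only [isInvariant_directSum_bot_iff hS]
  constructor
  · rintro htop K₁ ⟨-, hle⟩
    rwa [htop, top_le_iff, ClosedSubmodule.orthogonal_eq_top_iff] at hle
  · intro h
    have hbot := h _ ⟨isInvariant_orthogonal hS.1 (isInvariant_coupledPart₁ hS),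
      (ClosedSubmodule.orthogonal_gc ℂ H₁).le_u_l _⟩
    exact ClosedSubmodule.toSubmodule_injective
      (Submodule.orthogonal_eq_bot_iff.1 (congrArg ClosedSubmodule.toSubmodule hbot))

theorem coupledPart₂_eq_top_iff (hS : S.IsConservative) : S.coupledPart₂ = ⊤ ↔
    ∀ K₂ : ClosedSubmodule ℂ H₂, S.Ω.IsInvariant (directSum ⊥ K₂) → K₂ = ⊥ :=
  (coupledPart₁_eq_top_iff hS.swap).trans
    (forall_congr' fun _ => imp_congr_left (isInvariant_swap_directSum_iff hS))

theorem isReconstructible_iff_forall_isInvariant_eq_bot (hS : S.IsConservative) :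
    S.IsReconstructible ↔
      (∀ K₁ : ClosedSubmodule ℂ H₁, S.Ω.IsInvariant (directSum K₁ ⊥) → K₁ = ⊥) ∧
      ∀ K₂ : ClosedSubmodule ℂ H₂, S.Ω.IsInvariant (directSum ⊥ K₂) → K₂ = ⊥ := by
  rw [isReconstructible_iff hS, coupledPart₁_eq_top_iff hS, coupledPart₂_eq_top_iff hS]

end CoupledPart

end CoupledSystem

theorem mainTheorem2 {H₁ H₂ : Type*}
    [NormedAddCommGroup H₁] [InnerProductSpace ℂ H₁] [CompleteSpace H₁]
    [NormedAddCommGroup H₂] [InnerProductSpace ℂ H₂] [CompleteSpace H₂]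
    (S : CoupledSystem H₁ H₂) (hS : S.IsConservative) :
    ∃ (H₁c : ClosedSubmodule ℂ H₁) (H₂c : ClosedSubmodule ℂ H₂),
      -- `H' = H₁c ⊕ H₂c` is the smallest closed subspace that is `Ω`-invariant, splits along `H₁ ⊕ H₂`
      -- and contains `Ran Γ`
      IsLeast {K | S.IsSplitInvariantContainingRange K} (CoupledSystem.directSum H₁c H₂c) ∧
      -- there is exactly one minimal subspace with these properties
      (∃! K, Minimal S.IsSplitInvariantContainingRange K) ∧
      -- the restriction of `Ω` to `H'` is conservative
      IsSelfAdjoint (S.Ω.restrictTo (CoupledSystem.directSum H₁c H₂c)) ∧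
      -- the coupling restricts to `H'`
      (∀ v ∈ H₂c, S.Γ v ∈ H₁c) ∧ (∀ v ∈ H₁c, S.Γ.adjoint v ∈ H₂c) ∧
      -- (i)
      H₁c = S.Ω₁.orbit (Set.range S.Γ) ∧
      H₂c = S.Ω₂.orbit (Set.range S.Γ.adjoint) ∧
      -- (ii)
      (S.subsystem H₁c H₂c).IsReconstructible ∧
      (∀ K, S.IsMinimalExtensionWithin₁ K ↔ K = CoupledSystem.directSum ⊤ H₂c) ∧
      (∀ K, S.IsMinimalExtensionWithin₂ K ↔ K = CoupledSystem.directSum H₁c ⊤) ∧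
      -- the state spaces of these minimal extensions are the orbits of `H₁` and of `H₂`
      S.Ω.orbit (CoupledSystem.directSum (⊤ : ClosedSubmodule ℂ H₁)
        (⊥ : ClosedSubmodule ℂ H₂) : Set (WithLp 2 (H₁ × H₂))) =
          CoupledSystem.directSum ⊤ H₂c ∧
      S.Ω.orbit (CoupledSystem.directSum (⊥ : ClosedSubmodule ℂ H₁)
        (⊤ : ClosedSubmodule ℂ H₂) : Set (WithLp 2 (H₁ × H₂))) =
          CoupledSystem.directSum H₁c ⊤ ∧
      -- (iii)
      (∀ t : ℝ,
        (∀ v : H₁c.toSubmodule,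
          S.a₁ t v = ((S.subsystem H₁c H₂c).a₁ t v : H₁c.toSubmodule)) ∧
        (∀ v ∈ H₁c.toSubmoduleᗮ, S.a₁ t v = 0) ∧
        (∀ v : H₂c.toSubmodule,
          S.a₂ t v = ((S.subsystem H₁c H₂c).a₂ t v : H₂c.toSubmodule)) ∧
        (∀ v ∈ H₂c.toSubmoduleᗮ, S.a₂ t v = 0)) ∧
      (∀ (K₁ : ClosedSubmodule ℂ H₁) (K₂ : ClosedSubmodule ℂ H₂),
        S.Ω.IsInvariant (CoupledSystem.directSum K₁ K₂) →
        CoupledSystem.directSum K₁ K₂ < CoupledSystem.directSum H₁c H₂c →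
        ¬ S.Determines₁ K₁ K₂ ∧ ¬ S.Determines₂ K₁ K₂) ∧
      -- (iv)
      (S.IsReconstructible ↔
        (∀ K₁ : ClosedSubmodule ℂ H₁,
          S.Ω.IsInvariant (CoupledSystem.directSum K₁ ⊥) → K₁ = ⊥) ∧
        (∀ K₂ : ClosedSubmodule ℂ H₂,
          S.Ω.IsInvariant (CoupledSystem.directSum ⊥ K₂) → K₂ = ⊥)) := by
  have hinv := CoupledSystem.isInvariant_directSum_coupledPart hS
  have hΓ := CoupledSystem.Γ_mem_coupledPart₁ hS
  have hΓadj := CoupledSystem.adjoint_Γ_mem_coupledPart₂ hS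
  exact ⟨S.coupledPart₁, S.coupledPart₂,
    CoupledSystem.isLeast_directSum_coupledPart hS,
    CoupledSystem.existsUnique_minimal_isSplitInvariantContainingRange hS,
    UnboundedOperator.isSelfAdjoint_restrictTo (CoupledSystem.isSelfAdjoint_Ω hS) hinv,
    fun v _ => hΓ v, fun v _ => hΓadj v, rfl, rfl,
    CoupledSystem.isReconstructible_subsystem_coupledPart hS,
    CoupledSystem.isMinimalExtensionWithin₁_iff hS,
    CoupledSystem.isMinimalExtensionWithin₂_iff hS,
    CoupledSystem.orbit_directSum_top_bot hS,
    CoupledSystem.orbit_directSum_bot_top hS,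
    fun t => ⟨CoupledSystem.a₁_eq_subsystem_a₁ hS hinv t,
      fun _ hv => CoupledSystem.a₁_eq_zero hΓ hv t,
      CoupledSystem.a₂_eq_subsystem_a₂ hS hinv t,
      fun _ hv => CoupledSystem.a₂_eq_zero hΓadj hv t⟩,
    fun _ _ h hlt => ⟨
      fun hdet => hlt.not_ge (CoupledSystem.directSum_coupledPart_le_of_determines₁ hS h hdet),
      fun hdet => hlt.not_ge (CoupledSystem.directSum_coupledPart_le_of_determines₂ hS h hdet)⟩,
    CoupledSystem.isReconstructible_iff_forall_isInvariant_eq_bot hS⟩
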